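/- **Setting.** Let $N$ be a smooth finite-dimensional manifold with a smooth pseudo-Riemannian metric $T_2$, and let $\pi\colon TN\to N$ be its tangent bundle. For a horizontal 1-form $\tau$ on $TN$ put $\dot\tau(v)=\langle\tau,v\rangle$. Let $\theta_v=i_vT_2$ be the Liouville form transported to $TN$, $\omega_2=d\theta$, and $T=\tfrac12\dot\theta$ the kinetic energy. A *second order equation* is a smooth vector field $D$ on $TN$ with $\pi_*(D_v)=v$ for all $v\in TN$. The equation of motion of the system $(N,T_2,\alpha)$, with $\alpha$ a horizontal 1-form, is the second order equation $D$ with $i_D\omega_2+dT+\alpha=0$. The system is *free* if $\alpha=0$ (then $D$ is the geodesic field $D_G$), and *conservative* if $\alpha=dU$ with $U\in C^\infty(N)$. Imposing on $(N,T_2,\alpha)$ the *time constraint* $\tau$ means replacing $D$ by the second order equation $\overline D$ with $i_{\overline D}\omega_2+dT+\alpha\equiv 0 \pmod\tau$ and $\overline D\dot\tau=0$, and restricting it to the hypersurface $\dot\tau=1$ of $TN$. The time constraint is *holonomic* if $\tau=df$ for some $f\in C^\infty(N)$. **Theorem.** Let $(M',T_2',dU)$ be a conservative system, with $M'$ of dimension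 $m$. It has a unique equation of motion $D'$. Every point of $M'$ has an open neighbourhood $W$ for which (A) and (B) below hold. More precisely, (A) and (B) hold for every open $W\subseteq M'$ on which $U$ omits at least one real value (in particular for $W=M'$ if $U\colon M'\to\mathbb R$ is not surjective). Let $x^0$ be the coordinate of the factor $\mathbb R$ in the $(m+1)$-dimensional manifold $W\times\mathbb R$. **(A)** There is a nowhere zero $g_{00}\in C^\infty(W)$ such that, for the pseudo-Riemannian metric $T_2=g_{00}(dx^0)^2+T_2'$ on $W\times\mathbb R$, the holonomic time constraint $\tau=dx^0$ imposed on the free system $(W\times\mathbb R,T_2,0)$ yields a unique field $\overline D$, and the restriction of $\overline D$ to $\{\dot x^0=1\}\subset T(W\times\mathbb R)$ projects onto $D'|_{TW}$ (that is, $\{\dot x^0=1\}$ maps onto $TW$ under the map $T(W\times\mathbb R)\to TM'$ induced by $W\times\mathbb R\to W\subseteq M'$, and this map carries $\overline D_v$ to the value of $D'$ at the image of $v$). **(B)** There is a nowhere zero $g_{00}\in C^\infty(W)$ (in general different from the one in (A)) such that, for the pseudo-Riemannian metric $T_2=g_{00}(dx^0)^2+T_2'$ on $W\times\mathbb R$ and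 $\tau=g_{00}\,dx^0$, the free system $(W\times\mathbb R,T_2,0)$ has a unique geodesic field $D_G$, $D_G$ is tangent to the hypersurfaces $\dot\tau=\mathrm{const}$ (that is, $D_G\dot\tau=0$), and the restriction of $D_G$ to $\{\dot\tau=1\}$ projects onto $D'|_{TW}$ in the same sense. This time constraint is non-holonomic, except in the trivial case: if $\tau$ is the differential of a smooth function on $W\times\mathbb R$, then $dU=0$ on $W$. -/

import Mathlib

open Set Bundle TopologicalSpace
open scoped Manifold ContDiff

noncomputable section

namespace Mechanics

section General

variable {E : Type*} [NormedAddCommGroup E] [NormedSpace ℝ E]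
  {H : Type*} [TopologicalSpace H] (I : ModelWithCorners ℝ E H)
  (N : Type*) [TopologicalSpace N] [ChartedSpace H N]

/-- A (not necessarily continuous) differential 1-form on a manifold. -/
abbrev OneForm : Type _ := ∀ x : N, TangentSpace I x →L[ℝ] ℝ

variable {I N}

/-- The exterior derivative of a 1-form `η` at the point `x`, evaluated at two tangent vectors:
in the coordinates given by the preferred chart at `x` it is
`(v, w) ↦ (D_v η) w - (D_w η) v`, so that `d (p dx) = dp ∧ dx`. -/
def extDerivOneForm (η : OneForm I N) (x : N) (v w : TangentSpace I x) : ℝ :=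
  let φ := extChartAt I x
  let ηc : E → E →L[ℝ] ℝ := fun y =>
    (η (φ.symm y)).comp (mfderivWithin 𝓘(ℝ, E) I φ.symm (range I) y)
  let v' : E := mvfderiv I φ x v
  let w' : E := mvfderiv I φ x w
  fderivWithin ℝ ηc (range I) (φ x) v' w' - fderivWithin ℝ ηc (range I) (φ x) w' v'

variable (I N)

/-- A smooth pseudo-Riemannian (symmetric and non-degenerate) metric. -/
structure PseudoRiemannianMetric [IsManifold I ∞ N] where
  /-- The scalar product on each tangent space. -/
  val (x : N) : TangentSpace I x →L[ℝ] TangentSpace I x →L[ℝ] ℝ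
  symm (x : N) (v w : TangentSpace I x) : val x v w = val x w v
  nondegenerate (x : N) (v : TangentSpace I x) (hv : ∀ w, val x v w = 0) : v = 0
  contMDiff : ContMDiff I (I.prod 𝓘(ℝ, E →L[ℝ] E →L[ℝ] ℝ)) ∞
    (fun x => TotalSpace.mk' (E →L[ℝ] E →L[ℝ] ℝ)
      (E := fun x : N => TangentSpace I x →L[ℝ] TangentSpace I x →L[ℝ] ℝ) x (val x))

variable [IsManifold I ∞ N]

/-- The differential `d π` at `v` of the projection `π : TN → N`. -/
def projDeriv (v : TangentBundle I N) : TangentSpace I.tangent v →L[ℝ] TangentSpace I v.proj :=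
  mfderiv I.tangent I (fun u : TangentBundle I N => u.proj) v

/-- A horizontal 1-form on `TN`, written as a covector at `π v` for each `v` in `TN`. -/
abbrev HorizontalForm : Type _ := ∀ v : TangentBundle I N, TangentSpace I v.proj →L[ℝ] ℝ

/-- A tangent vector field on `TN` (smoothness is required separately). -/
abbrev FieldOnTangent : Type _ := ∀ v : TangentBundle I N, TangentSpace I.tangent v

variable {I N}

namespace HorizontalForm

/-- The 1-form on `TN` given by a horizontal form; it annihilates the vertical vectors. -/
def toOneForm (α : HorizontalForm I N) : OneForm I.tangent (TangentBundle I N) :=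
  fun v => (α v).comp (projDeriv I N v)

/-- The function `v ↦ ⟨α, v⟩` on `TN` defined by a horizontal form `α`. -/
def dot (α : HorizontalForm I N) (v : TangentBundle I N) : ℝ := α v v.snd

/-- A 1-form on `N`, regarded as a horizontal form on `TN` by pull-back. -/
def ofBase (β : OneForm I N) : HorizontalForm I N := fun v => β v.proj

end HorizontalForm

namespace PseudoRiemannianMetric

variable (g : PseudoRiemannianMetric I N)

/-- The Liouville form of `T*N`, transported to `TN` by the metric: `θ_v = i_v g`. -/
def liouville : HorizontalForm I N := fun v => g.val v.proj v.snd

/-- The symplectic form `ω₂ = dθ` on `TN`. -/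
def omega (v : TangentBundle I N) (ξ ζ : TangentSpace I.tangent v) : ℝ :=
  extDerivOneForm (g.liouville.toOneForm) v ξ ζ

/-- The kinetic energy. -/
def kinetic (v : TangentBundle I N) : ℝ := (1 / 2) * g.liouville.dot v

/-- The left-hand side `i_D ω₂ + dT + α` of Newton's equation. -/
def newtonForm (α : HorizontalForm I N) (D : FieldOnTangent I N)
    (v : TangentBundle I N) (ξ : TangentSpace I.tangent v) : ℝ :=
  g.omega v (D v) ξ + mvfderiv I.tangent g.kinetic v ξ + α.toOneForm v ξ

end PseudoRiemannianMetric

/-- A second order differential equation on `N`: a smooth tangent field `D` on `TN` with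
`π_* (D_v) = v` for every `v`. -/
structure IsSecondOrder (D : FieldOnTangent I N) : Prop where
  contMDiff : ContMDiff I.tangent I.tangent.tangent ∞
    (fun v => (⟨v, D v⟩ : TangentBundle I.tangent (TangentBundle I N)))
  proj (v : TangentBundle I N) : projDeriv I N v (D v) = v.snd

/-- `D` is the differential equation of motion of the mechanical system `(N, g, α)`. -/
structure IsEquationOfMotion (g : PseudoRiemannianMetric I N) (α : HorizontalForm I N)
    (D : FieldOnTangent I N) : Prop extends IsSecondOrder D where
  newton (v : TangentBundle I N) (ξ : TangentSpace I.tangent v) : g.newtonForm α D v ξ = 0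

/-- `D` is the geodesic field of `(N, g)`: the equation of motion of the force-free system. -/
def IsGeodesicField (g : PseudoRiemannianMetric I N) (D : FieldOnTangent I N) : Prop :=
  IsEquationOfMotion g (fun _ => 0) D

/-- `D` is tangent to all the hypersurfaces `τ̇ = const` of `TN`, that is `D τ̇ = 0`. -/
def IsTangentTo (D : FieldOnTangent I N) (τ : HorizontalForm I N) : Prop :=
  ∀ v : TangentBundle I N, mvfderiv I.tangent τ.dot v (D v) = 0

/-- `D` governs the evolution of the system `(N, g, α)` under the time constraint `τ`: it is a
second order equation, `i_D ω₂ + dT + α ≡ 0 (mod τ)`, and `D` is tangent to `τ̇ = const`. -/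
structure IsTimeConstrained (g : PseudoRiemannianMetric I N) (α τ : HorizontalForm I N)
    (D : FieldOnTangent I N) : Prop extends IsSecondOrder D where
  newton : ∃ c : TangentBundle I N → ℝ, ∀ (v : TangentBundle I N) (ξ : TangentSpace I.tangent v),
    g.newtonForm α D v ξ = c v * τ.toOneForm v ξ
  tangent : IsTangentTo D τ

/-- The time constraint `τ` is holonomic: `τ` is the differential of a smooth function on `N`. -/
def IsHolonomic (τ : HorizontalForm I N) : Prop :=
  ∃ f : N → ℝ, ContMDiff I 𝓘(ℝ, ℝ) ∞ f ∧ τ = HorizontalForm.ofBase fun x => mvfderiv I f x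

end General

section Extension

variable {E : Type*} [NormedAddCommGroup E] [NormedSpace ℝ E]
  {M' : Type*} [TopologicalSpace M'] [ChartedSpace E M'] [IsManifold 𝓘(ℝ, E) ∞ M']

/-- The model of the manifold `W × ℝ`, of one dimension more than `M'`. -/
abbrev extModel (E : Type*) [NormedAddCommGroup E] [NormedSpace ℝ E] :
    ModelWithCorners ℝ (E × ℝ) (ModelProd E ℝ) := 𝓘(ℝ, E).prod 𝓘(ℝ, ℝ)

/-- The projection `W × ℝ → M'`, for `W` open in `M'`. -/
def baseProj (W : Opens M') (z : W × ℝ) : M' := z.1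

/-- The function `x⁰` on `W × ℝ`: the projection to `ℝ`. -/
def timeCoord (W : Opens M') (z : W × ℝ) : ℝ := z.2

/-- The 1-form `dx⁰` on `W × ℝ`. -/
def dTime (W : Opens M') : OneForm (extModel E) (W × ℝ) :=
  fun z => mvfderiv (extModel E) (timeCoord W) z

/-- The metric `T₂` on `W × ℝ` is `g₀₀ (dx⁰)² + T₂'`, where `g₀₀` is a function on `W`. -/
def IsStaticExtension (T' : PseudoRiemannianMetric 𝓘(ℝ, E) M') (W : Opens M')
    (g₀₀ : W → ℝ) (T : PseudoRiemannianMetric (extModel E) (W × ℝ)) : Prop :=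
  ∀ (z : W × ℝ) (v w : TangentSpace (extModel E) z),
    T.val z v w = g₀₀ z.1 * dTime W z v * dTime W z w +
      T'.val (baseProj W z) (mfderiv (extModel E) 𝓘(ℝ, E) (baseProj W) z v)
        (mfderiv (extModel E) 𝓘(ℝ, E) (baseProj W) z w)

/-- The specialization of the field `D` on `T(W × ℝ)` to the hypersurface `τ̇ = 1` projects onto
the field `D'` on `TW ⊆ TM'`. -/
def SpecializationProjectsTo (W : Opens M') (τ : HorizontalForm (extModel E) (W × ℝ))
    (D : FieldOnTangent (extModel E) (W × ℝ)) (D' : FieldOnTangent 𝓘(ℝ, E) M') : Prop :=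
  (∀ u : TangentBundle 𝓘(ℝ, E) M', u.proj ∈ W →
    ∃ v : TangentBundle (extModel E) (W × ℝ), τ.dot v = 1 ∧
      tangentMap (extModel E) 𝓘(ℝ, E) (baseProj W) v = u) ∧
  ∀ v : TangentBundle (extModel E) (W × ℝ), τ.dot v = 1 →
    mfderiv (extModel E).tangent 𝓘(ℝ, E).tangent
      (tangentMap (extModel E) 𝓘(ℝ, E) (baseProj W)) v (D v) =
    D' (tangentMap (extModel E) 𝓘(ℝ, E) (baseProj W) v)

/-- Over `W`, the field `D'` is obtained from a force-free system on `W × ℝ` by imposing the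
holonomic time constraint `τ = dx⁰`. -/
def IsHolonomicTimeConstraintOver (T' : PseudoRiemannianMetric 𝓘(ℝ, E) M')
    (D' : FieldOnTangent 𝓘(ℝ, E) M') (W : Opens M') : Prop :=
  ∃ (g₀₀ : W → ℝ) (T : PseudoRiemannianMetric (extModel E) (W × ℝ)),
    ContMDiff 𝓘(ℝ, E) 𝓘(ℝ, ℝ) ∞ g₀₀ ∧ (∀ q, g₀₀ q ≠ 0) ∧
    IsStaticExtension T' W g₀₀ T ∧
    IsHolonomic (I := extModel E) (HorizontalForm.ofBase (dTime W)) ∧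
    (∃! D, IsTimeConstrained T (fun _ => 0) (HorizontalForm.ofBase (dTime W)) D) ∧
    ∀ D, IsTimeConstrained T (fun _ => 0) (HorizontalForm.ofBase (dTime W)) D →
      SpecializationProjectsTo W (HorizontalForm.ofBase (dTime W)) D D'

/-- Over `W`, the field `D'` is the projection of the specialization of a force-free system on
`W × ℝ` to the time constraint `τ = g₀₀ dx⁰`, to which the geodesic field is tangent. The
constraint is non-holonomic, except in the trivial case `dU = 0`. -/
def IsNonholonomicTimeConstraintOver (T' : PseudoRiemannianMetric 𝓘(ℝ, E) M') (U : M' → ℝ)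
    (D' : FieldOnTangent 𝓘(ℝ, E) M') (W : Opens M') : Prop :=
  ∃ (g₀₀ : W → ℝ) (T : PseudoRiemannianMetric (extModel E) (W × ℝ)),
    ContMDiff 𝓘(ℝ, E) 𝓘(ℝ, ℝ) ∞ g₀₀ ∧ (∀ q, g₀₀ q ≠ 0) ∧
    IsStaticExtension T' W g₀₀ T ∧
    (IsHolonomic (I := extModel E) (HorizontalForm.ofBase fun z => g₀₀ z.1 • dTime W z) →
      ∀ q ∈ W, mvfderiv 𝓘(ℝ, E) U q = 0) ∧
    (∃! D, IsGeodesicField T D) ∧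
    ∀ D, IsGeodesicField T D →
      IsTangentTo D (HorizontalForm.ofBase fun z => g₀₀ z.1 • dTime W z) ∧
      SpecializationProjectsTo W (HorizontalForm.ofBase fun z => g₀₀ z.1 • dTime W z) D D'

end Extension

end Mechanics

end

/-! In a chart in which the metric has coefficients `G`, Newton's equation for a second order field
with velocity `e` and acceleration `b` says that the Euler-Lagrange covector `G(b, ·) + DG(e)(e, ·)
- ½ DG(·)(e, e)` plus the force vanishes (`newtonForm_eq`). Nondegeneracy makes this solvable for
`b` in exactly one way, so every smooth horizontal force has a unique equation of motion; smoothness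
of the solution rests on its covariance under changes of chart (`accelForm_pullback`,
`acceleration_transition`).

For the static metric `f (dx⁰)² + T'` the covector splits (`accelForm_staticMetric`). Its time part
is `f ẍ⁰ + df(ẋ) ẋ⁰`, which is the derivative of `f ẋ⁰` along the motion. Its spatial part is that
of `T'` plus `-½ (ẋ⁰)² df`, so time acts on space as the force `-½ (ẋ⁰)² df`, and it remains to
choose `f` so that this force is `dU`.

(A) The constraint `dx⁰` forces `ẍ⁰ = 0` and leaves the spatial part untouched. On `ẋ⁰ = 1` the
force is `-½ df`, which is `dU` for `f = 2 (c - U)`.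

(B) Along a geodesic `f ẋ⁰` is constant. On `f ẋ⁰ = 1` the force is `-½ df / f² = ½ d(1/f)`, which
is `dU` for `f = 1 / (2 (U - c))`. If `f dx⁰` is exact then `df ∧ dx⁰ = 0`, so `df = 0` and hence
`dU = 0`.

In both cases `f` is finite and nowhere zero because `U` omits the value `c` on `W`. -/

noncomputable section

namespace Mechanics

set_option maxSynthPendingDepth 3

/-! ### Preferred charts of a manifold and of its tangent bundle -/

section Charts

variable {E : Type*} [NormedAddCommGroup E] [NormedSpace ℝ E]
  {H : Type*} [TopologicalSpace H] {I : ModelWithCorners ℝ E H}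
  {N : Type*} [TopologicalSpace N] [ChartedSpace H N]

theorem mvfderiv_apply_eq {F : Type*} [NormedAddCommGroup F] [NormedSpace ℝ F] (f : N → F) (x : N)
    (v : TangentSpace I x) : mvfderiv I f x v = mfderiv I 𝓘(ℝ, F) f x v := rfl

/-- The derivative of a real function on a manifold, computed in the preferred chart. -/
theorem mvfderiv_apply_of_hasFDerivAt [I.Boundaryless] {f : N → ℝ} {x : N} {f' : E →L[ℝ] ℝ}
    (h : HasFDerivAt (f ∘ (extChartAt I x).symm) f' (extChartAt I x x)) (v : TangentSpace I x) :
    mvfderiv I f x v = f' v := by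
  have hc : ContinuousAt f x := by
    have := h.continuousAt.comp (continuousAt_extChartAt (I := I) x)
    refine this.congr ?_
    filter_upwards [extChartAt_source_mem_nhds (I := I) x] with y hy
    exact congrArg f ((extChartAt I x).left_inv hy)
  have : HasMFDerivAt I 𝓘(ℝ, ℝ) f x f' := by
    refine ⟨hc, ?_⟩
    have h' : HasFDerivWithinAt (f ∘ (extChartAt I x).symm) f' (range I) (extChartAt I x x) :=
      h.hasFDerivWithinAt
    exact h'
  rw [mvfderiv_apply_eq, this.mfderiv]
  rfl

theorem mfderiv_eq_of_hasFDerivAt [I.Boundaryless]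
    {E' : Type*} [NormedAddCommGroup E'] [NormedSpace ℝ E']
    {H' : Type*} [TopologicalSpace H'] {I' : ModelWithCorners ℝ E' H'}
    {N' : Type*} [TopologicalSpace N'] [ChartedSpace H' N'] {f : N → N'} {x : N}
    (hc : ContinuousAt f x) {F : E → E'} {F' : E →L[ℝ] E'}
    (h : HasFDerivAt F F' (extChartAt I x x))
    (hF : writtenInExtChartAt I I' x f =ᶠ[nhds (extChartAt I x x)] F) :
    mfderiv I I' f x = F' := by
  have : HasMFDerivAt I I' f x F' := by
    refine ⟨hc, ?_⟩
    exact (h.congr_of_eventuallyEq hF).hasFDerivWithinAt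
  exact this.mfderiv

theorem extChartAt_target_mem_nhds_of_mem [I.Boundaryless] {x₀ : N} {z : E}
    (hz : z ∈ (extChartAt I x₀).target) : (extChartAt I x₀).target ∈ nhds z :=
  (isOpen_extChartAt_target x₀).mem_nhds hz

theorem eventually_mem_source_symm [I.Boundaryless] {x₀ x₁ : N} {z : E}
    (hz : z ∈ (extChartAt I x₀).target)
    (hz' : (extChartAt I x₀).symm z ∈ (extChartAt I x₁).source) :
    ∀ᶠ y in nhds z, y ∈ (extChartAt I x₀).target ∧
      (extChartAt I x₀).symm y ∈ (extChartAt I x₁).source :=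
  Filter.Eventually.and (extChartAt_target_mem_nhds_of_mem hz)
    ((continuousAt_extChartAt_symm'' hz).preimage_mem_nhds
      ((isOpen_extChartAt_source x₁).mem_nhds hz'))

variable [IsManifold I ∞ N]

variable (I) in
/-- The change of coordinates between two preferred charts. -/
def transition (x₀ x₁ : N) : E → E := extChartAt I x₁ ∘ (extChartAt I x₀).symm

variable (I) in
/-- The derivative of the inverse of the preferred chart at `x₀`, as an endomorphism of the model
space. -/
def frame (x₀ : N) (z : E) : E →L[ℝ] E :=
  tangentCoordChange I x₀ ((extChartAt I x₀).symm z) ((extChartAt I x₀).symm z)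

/-- This links `frame` to the derivative of the inverse chart that occurs in `extDerivOneForm`. -/
theorem frame_eq_mfderivWithin {x₀ : N} {z : E} (hz : z ∈ (extChartAt I x₀).target) :
    frame I x₀ z = mfderivWithin 𝓘(ℝ, E) I (extChartAt I x₀).symm (range I) z := by
  have hs : (extChartAt I x₀).symm z ∈ (chartAt H x₀).source := by
    simpa using (extChartAt I x₀).map_target hz
  have h1 := TangentBundle.symmL_trivializationAt (I := I) hs
  have h2 := TangentBundle.symmL_trivializationAt_eq_core (I := I) hs
  rw [h2, (extChartAt I x₀).right_inv hz] at h1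
  exact h1

/-- A tangent vector at `x` is stored as an element of `E` by means of the preferred chart at `x`
itself, so at the centre of the chart no change of coordinates is left. -/
theorem frame_self (x : N) : frame I x (extChartAt I x x) = ContinuousLinearMap.id ℝ E := by
  ext e
  simp only [frame, extChartAt_to_inv]
  exact tangentCoordChange_self (mem_extChartAt_source x)

theorem fderiv_transition [I.Boundaryless] {x₀ x₁ : N} {z : E} (hz : z ∈ (extChartAt I x₀).target) :
    fderiv ℝ (transition I x₀ x₁) z = tangentCoordChange I x₀ x₁ ((extChartAt I x₀).symm z) := by
  rw [tangentCoordChange_def, I.range_eq_univ, fderivWithin_univ, (extChartAt I x₀).right_inv hz]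
  rfl

theorem fderiv_transition_surjective [I.Boundaryless] {x₀ x₁ : N} {z : E}
    (hz : z ∈ (extChartAt I x₀).target)
    (hz' : (extChartAt I x₀).symm z ∈ (extChartAt I x₁).source) :
    Function.Surjective (fderiv ℝ (transition I x₀ x₁) z) := by
  intro a
  have hs := (extChartAt I x₀).map_target hz
  refine ⟨tangentCoordChange I x₁ x₀ ((extChartAt I x₀).symm z) a, ?_⟩
  rw [fderiv_transition hz, tangentCoordChange_comp ⟨⟨hz', hs⟩, hz'⟩, tangentCoordChange_self hz']

/-- This is the chain rule for the inverse chart at `x₀`, factored through the chart at `x₁`; the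
transformation laws of metrics and horizontal forms follow from it. -/
theorem frame_transition [I.Boundaryless] {x₀ x₁ : N} {z : E} (hz : z ∈ (extChartAt I x₀).target)
    (hz' : (extChartAt I x₀).symm z ∈ (extChartAt I x₁).source) :
    frame I x₀ z = (frame I x₁ (transition I x₀ x₁ z)).comp
      (fderiv ℝ (transition I x₀ x₁) z) := by
  rw [fderiv_transition hz]
  ext e
  simp only [frame, ContinuousLinearMap.comp_apply, transition, Function.comp_apply,
    (extChartAt I x₁).left_inv hz']
  exact (tangentCoordChange_comp ⟨⟨(extChartAt I x₀).map_target hz, hz'⟩,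
    mem_extChartAt_source _⟩).symm

theorem contDiffAt_transition [I.Boundaryless] {x₀ x₁ : N} {z : E}
    (hz : z ∈ (extChartAt I x₀).target)
    (hz' : (extChartAt I x₀).symm z ∈ (extChartAt I x₁).source) :
    ContDiffAt ℝ ∞ (transition I x₀ x₁) z := by
  have := contDiffWithinAt_ext_coord_change (I := I) (n := ∞) x₁ x₀ (y := z)
    (by rw [PartialEquiv.trans_source]; exact ⟨hz, hz'⟩)
  rw [I.range_eq_univ, contDiffWithinAt_univ] at this
  exact this

theorem extChartAt_tangent_target (v₀ : TangentBundle I N) :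
    (extChartAt I.tangent v₀).target = (extChartAt I v₀.proj).target ×ˢ univ := by
  rw [FiberBundle.extChartAt_target]
  congr 1
  refine inter_eq_left.mpr fun z hz => ?_
  simpa using (extChartAt I v₀.proj).map_target hz

theorem extChartAt_tangent_apply (v₀ u : TangentBundle I N) :
    extChartAt I.tangent v₀ u = (extChartAt I v₀.proj u.proj,
      tangentCoordChange I u.proj v₀.proj u.proj u.snd) := by
  rw [FiberBundle.extChartAt]
  rfl

/-- The components of a tangent vector in the preferred chart at its base point. -/
def components (v : TangentBundle I N) : E := v.snd

theorem extChartAt_tangent_self (v : TangentBundle I N) :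
    extChartAt I.tangent v v = (extChartAt I v.proj v.proj, components v) := by
  rw [extChartAt_tangent_apply]
  exact Prod.ext rfl (tangentCoordChange_self (mem_extChartAt_source _))

theorem extChartAt_tangent_symm_apply (v₀ : TangentBundle I N) {y : E × E}
    (hy : y.1 ∈ (extChartAt I v₀.proj).target) :
    (extChartAt I.tangent v₀).symm y =
      ⟨(extChartAt I v₀.proj).symm y.1, frame I v₀.proj y.1 y.2⟩ := by
  have ht : y ∈ (extChartAt I.tangent v₀).target := by
    rw [extChartAt_tangent_target]; exact ⟨hy, mem_univ _⟩
  apply (extChartAt I.tangent v₀).injOn ((extChartAt I.tangent v₀).map_target ht)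
  · rw [extChartAt_source]
    simpa using (extChartAt I v₀.proj).map_target hy
  · rw [(extChartAt I.tangent v₀).right_inv ht, extChartAt_tangent_apply]
    refine Prod.ext ((extChartAt I v₀.proj).right_inv hy).symm ?_
    simp only [frame]
    have hs := (extChartAt I v₀.proj).map_target hy
    rw [tangentCoordChange_comp ⟨⟨hs, mem_extChartAt_source _⟩, hs⟩, tangentCoordChange_self hs]

/-- The preferred charts of `TN` change by the tangent map of the change of coordinates. -/
theorem transition_tangent_apply [I.Boundaryless] (v₀ v₁ : TangentBundle I N) {y : E × E}
    (hy : y.1 ∈ (extChartAt I v₀.proj).target)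
    (hy' : (extChartAt I v₀.proj).symm y.1 ∈ (extChartAt I v₁.proj).source) :
    transition I.tangent v₀ v₁ y = (transition I v₀.proj v₁.proj y.1,
      fderiv ℝ (transition I v₀.proj v₁.proj) y.1 y.2) := by
  simp only [transition, Function.comp_apply]
  rw [extChartAt_tangent_symm_apply v₀ hy, extChartAt_tangent_apply]
  refine Prod.ext rfl ?_
  have hs := (extChartAt I v₀.proj).map_target hy
  refine Eq.trans ?_
    (congrArg (fun L : E →L[ℝ] E => L y.2) (fderiv_transition (x₁ := v₁.proj) hy)).symm
  exact tangentCoordChange_comp ⟨⟨hs, mem_extChartAt_source _⟩, hy'⟩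

end Charts

/-! ### The Euler-Lagrange covector: covariance and solution for the acceleration -/

section Acceleration

variable {E : Type*} [NormedAddCommGroup E] [NormedSpace ℝ E]

/-- The Euler-Lagrange covector of the kinetic energy `½ G`, for position `x`, velocity `e` and
acceleration `b`. -/
def accelForm (G : E → E →L[ℝ] E →L[ℝ] ℝ) (x e b a : E) : ℝ :=
  G x b a + fderiv ℝ G x e e a - 1 / 2 * fderiv ℝ G x a e e

theorem hasFDerivAt_clm_apply₂ {F : Type*} [NormedAddCommGroup F] [NormedSpace ℝ F]
    {G : F → E →L[ℝ] E →L[ℝ] ℝ} {x : F} (hG : DifferentiableAt ℝ G x) (a b : E) :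
    HasFDerivAt (fun y => G y a b) (((fderiv ℝ G x).flip a).flip b) x := by
  have h := (hG.hasFDerivAt.clm_apply (hasFDerivAt_const a x)).clm_apply (hasFDerivAt_const b x)
  refine h.congr_fderiv ?_
  ext c
  simp

theorem fderiv_clm_apply₂ {F : Type*} [NormedAddCommGroup F] [NormedSpace ℝ F]
    {G : F → E →L[ℝ] E →L[ℝ] ℝ} {x : F} (hG : DifferentiableAt ℝ G x) (a b : E) (c : F) :
    fderiv ℝ (fun y => G y a b) x c = fderiv ℝ G x c a b := by
  rw [(hasFDerivAt_clm_apply₂ hG a b).fderiv]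
  simp

/-- The derivative of the pull-back of a field of bilinear forms by a change of coordinates. -/
theorem fderiv_pullback_bilin {G G' : E → E →L[ℝ] E →L[ℝ] ℝ} {κ : E → E} {x : E}
    (hG : DifferentiableAt ℝ G x) (hG' : DifferentiableAt ℝ G' (κ x)) (hκ : ContDiffAt ℝ ∞ κ x)
    (h : ∀ᶠ y in nhds x, ∀ a b, G y a b = G' (κ y) (fderiv ℝ κ y a) (fderiv ℝ κ y b))
    (a b c : E) :
    fderiv ℝ G x c a b =
      fderiv ℝ G' (κ x) (fderiv ℝ κ x c) (fderiv ℝ κ x a) (fderiv ℝ κ x b) +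
      G' (κ x) (fderiv ℝ (fderiv ℝ κ) x c a) (fderiv ℝ κ x b) +
      G' (κ x) (fderiv ℝ κ x a) (fderiv ℝ (fderiv ℝ κ) x c b) := by
  have hd : DifferentiableAt ℝ (fderiv ℝ κ) x :=
    (hκ.fderiv_right (m := 1) (by norm_cast)).differentiableAt one_ne_zero
  have hk : DifferentiableAt ℝ κ x := hκ.differentiableAt (by simp)
  have h1 : (fun y => G y a b) =ᶠ[nhds x]
      fun y => G' (κ y) (fderiv ℝ κ y a) (fderiv ℝ κ y b) := h.mono fun y hy => hy a b
  have h2 : ∀ a, HasFDerivAt (fun y => fderiv ℝ κ y a) ((fderiv ℝ (fderiv ℝ κ) x).flip a) x := by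
    intro a
    refine (hd.hasFDerivAt.clm_apply (hasFDerivAt_const a x)).congr_fderiv ?_
    ext c
    simp
  have h4 : HasFDerivAt (fun y => G' (κ y)) ((fderiv ℝ G' (κ x)).comp (fderiv ℝ κ x)) x :=
    hG'.hasFDerivAt.comp x hk.hasFDerivAt
  have h3 := (h4.clm_apply (h2 a)).clm_apply (h2 b)
  rw [← fderiv_clm_apply₂ hG, h1.fderiv_eq, HasFDerivAt.fderiv h3]
  simp
  ring

/-- Differentiating the pulled-back metric produces terms in `D²κ`. Those containing `D²κ(e, a)`
cancel, by symmetry of `D²κ` and of `G'`; the remaining one, `G'(D²κ(e, e), Dκ a)`, is exactly the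
inhomogeneous term in the transformation of an acceleration. -/
theorem accelForm_pullback {G G' : E → E →L[ℝ] E →L[ℝ] ℝ} {κ : E → E} {x : E}
    (hG : DifferentiableAt ℝ G x) (hG' : DifferentiableAt ℝ G' (κ x)) (hκ : ContDiffAt ℝ ∞ κ x)
    (hsymm : ∀ a b, G' (κ x) a b = G' (κ x) b a)
    (h : ∀ᶠ y in nhds x, ∀ a b, G y a b = G' (κ y) (fderiv ℝ κ y a) (fderiv ℝ κ y b))
    (e b a : E) :
    accelForm G x e b a = accelForm G' (κ x) (fderiv ℝ κ x e)
      (fderiv ℝ (fderiv ℝ κ) x e e + fderiv ℝ κ x b) (fderiv ℝ κ x a) := by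
  have hs : IsSymmSndFDerivAt ℝ κ x := hκ.isSymmSndFDerivAt (by
    rw [minSmoothness_of_isRCLikeNormedField]; norm_cast)
  simp only [accelForm, fderiv_pullback_bilin hG hG' hκ h, h.self_of_nhds b a, map_add,
    add_apply]
  rw [hs.eq a e, hsymm (fderiv ℝ (fderiv ℝ κ) x e a)]
  ring

variable [FiniteDimensional ℝ E]

/-- Nondegeneracy is injectivity of `E → E*`, and the two spaces have equal finite dimension. -/
theorem isInvertible_of_nondegenerate {B : E →L[ℝ] E →L[ℝ] ℝ}
    (hB : ∀ v, (∀ w, B v w = 0) → v = 0) : B.IsInvertible := by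
  have hinj : Function.Injective B.toLinearMap := by
    rw [← LinearMap.ker_eq_bot, LinearMap.ker_eq_bot']
    intro v hv
    exact hB v fun w => by
      have : B v = 0 := hv
      simp [this]
  have hd : Module.finrank ℝ E = Module.finrank ℝ (E →L[ℝ] ℝ) := by
    rw [(LinearMap.toContinuousLinearMap (𝕜 := ℝ) (E := E) (F' := ℝ)).symm.finrank_eq]
    exact (Subspace.dual_finrank_eq (K := ℝ) (V := E)).symm
  exact ⟨(LinearEquiv.ofInjectiveOfFinrankEq _ hinj hd).toContinuousLinearEquiv, by ext; rfl⟩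

/-- The acceleration solving `accelForm G x e b + β = 0`. -/
def acceleration (G : E → E →L[ℝ] E →L[ℝ] ℝ) (x e : E) (β : E →L[ℝ] ℝ) : E :=
  -(G x).inverse (fderiv ℝ G x e e - (1 / 2 : ℝ) • ((fderiv ℝ G x).flip e).flip e + β)

theorem accelForm_add_eq_zero_iff {G : E → E →L[ℝ] E →L[ℝ] ℝ} {x : E}
    (hG : ∀ v, (∀ w, G x v w = 0) → v = 0) (e b : E) (β : E →L[ℝ] ℝ) :
    (∀ a, accelForm G x e b a + β a = 0) ↔ b = acceleration G x e β := by
  obtain ⟨Φ, hΦ⟩ := isInvertible_of_nondegenerate hG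
  have : ∀ ψ : E →L[ℝ] ℝ, b = -(G x).inverse ψ ↔ G x b = -ψ := by
    intro ψ
    rw [← hΦ, ContinuousLinearMap.inverse_equiv]
    constructor
    · rintro rfl; simp
    · intro h
      have h' : Φ b = -ψ := h
      rw [← Φ.symm_apply_apply b, h']
      simp
  rw [acceleration, this, ContinuousLinearMap.ext_iff]
  refine forall_congr' fun a => ?_
  simp only [accelForm, neg_apply, add_apply, sub_apply, smul_apply, ContinuousLinearMap.flip_apply,
    smul_eq_mul]
  constructor <;> intro h <;> linarith

/-- Inversion of continuous linear maps is smooth at invertible ones; everything else in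
`acceleration` is built from bounded multilinear operations. -/
theorem contDiffAt_acceleration {F : Type*} [NormedAddCommGroup F] [NormedSpace ℝ F]
    {G : E → E →L[ℝ] E →L[ℝ] ℝ} {x e : F → E} {β : F → E →L[ℝ] ℝ} {y : F}
    (hG : ContDiffAt ℝ ∞ G (x y)) (hn : ∀ v, (∀ w, G (x y) v w = 0) → v = 0)
    (hx : ContDiffAt ℝ ∞ x y) (he : ContDiffAt ℝ ∞ e y) (hβ : ContDiffAt ℝ ∞ β y) :
    ContDiffAt ℝ ∞ (fun z => acceleration G (x z) (e z) (β z)) y := by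
  have hGx : ContDiffAt ℝ ∞ (fun z => G (x z)) y := hG.comp y hx
  have hDG : ContDiffAt ℝ ∞ (fun z => fderiv ℝ G (x z)) y :=
    (hG.fderiv_right (m := ∞) le_rfl).comp y hx
  refine ContDiffAt.neg (ContDiffAt.clm_apply ?_ ?_)
  · exact ((isInvertible_of_nondegenerate hn).contDiffAt_map_inverse).comp y hGx
  · have hflip : ContDiffAt ℝ ∞ (fun z => (fderiv ℝ G (x z)).flip) y :=
      (ContinuousLinearMap.flipₗᵢ ℝ E E (E →L[ℝ] ℝ)).contDiff.contDiffAt.comp y hDG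
    have hflip' : ContDiffAt ℝ ∞ (fun z => ((fderiv ℝ G (x z)).flip (e z)).flip) y :=
      (ContinuousLinearMap.flipₗᵢ ℝ E E ℝ).contDiff.contDiffAt.comp y (hflip.clm_apply he)
    exact (((hDG.clm_apply he).clm_apply he).sub ((hflip'.clm_apply he).const_smul _)).add hβ

end Acceleration

/-! ### Metrics and horizontal forms in coordinates -/

section Coordinates

variable {E : Type*} [NormedAddCommGroup E] [NormedSpace ℝ E]
  {H : Type*} [TopologicalSpace H] {I : ModelWithCorners ℝ E H}
  {N : Type*} [TopologicalSpace N] [ChartedSpace H N] [IsManifold I ∞ N]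

/-- The scalar product of two smooth vector fields along a map is smooth. -/
theorem PseudoRiemannianMetric.contMDiffAt_val (g : PseudoRiemannianMetric I N)
    {E' : Type*} [NormedAddCommGroup E'] [NormedSpace ℝ E'] {H' : Type*} [TopologicalSpace H']
    {I' : ModelWithCorners ℝ E' H'} {P : Type*} [TopologicalSpace P] [ChartedSpace H' P]
    {b : P → N} {v w : ∀ q, TangentSpace I (b q)} {p : P}
    (hv : ContMDiffAt I' I.tangent ∞ (fun q => (⟨b q, v q⟩ : TangentBundle I N)) p)
    (hw : ContMDiffAt I' I.tangent ∞ (fun q => (⟨b q, w q⟩ : TangentBundle I N)) p) :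
    ContMDiffAt I' 𝓘(ℝ, ℝ) ∞ (fun q => g.val (b q) (v q) (w q)) p := by
  have hb : ContMDiffAt I' I ∞ b p :=
    (contMDiff_proj (IB := I) (TangentSpace I : N → Type _)).contMDiffAt.comp p hv
  have hg : ContMDiffAt I' (I.prod 𝓘(ℝ, E →L[ℝ] E →L[ℝ] ℝ)) ∞
      (fun q => TotalSpace.mk' (E →L[ℝ] E →L[ℝ] ℝ)
        (E := fun x : N => TangentSpace I x →L[ℝ] TangentSpace I x →L[ℝ] ℝ) (b q)
        (g.val (b q))) p := g.contMDiff.contMDiffAt.comp p hb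
  have := ContMDiffAt.clm_bundle_apply₂ (F₁ := E) (F₂ := E) (F₃ := ℝ)
    (E₃ := fun _ : N => ℝ) (b := b) (v := v) (w := w) hg hv hw
  rw [contMDiffAt_totalSpace] at this
  exact this.2

/-- The preferred coordinates on `TN`, as a map from the model space. -/
theorem contMDiffAt_frame [I.Boundaryless] {x₀ : N} {y : E × E}
    (hy : y.1 ∈ (extChartAt I x₀).target) :
    ContMDiffAt 𝓘(ℝ, E × E) I.tangent ∞
      (fun y : E × E => (⟨(extChartAt I x₀).symm y.1, frame I x₀ y.1 y.2⟩ : TangentBundle I N))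
      y := by
  have ht : y ∈ (extChartAt I.tangent (⟨x₀, 0⟩ : TangentBundle I N)).target := by
    rw [extChartAt_tangent_target]
    exact ⟨hy, mem_univ _⟩
  have h := (contMDiffOn_extChartAt_symm (I := I.tangent) (n := ∞)
    (⟨x₀, 0⟩ : TangentBundle I N)).contMDiffAt (extChartAt_target_mem_nhds_of_mem ht)
  refine h.congr_of_eventuallyEq ?_
  filter_upwards [extChartAt_target_mem_nhds_of_mem ht] with z hz
  rw [extChartAt_tangent_target] at hz
  exact (extChartAt_tangent_symm_apply _ hz.1).symm

theorem contMDiffAt_frame_const [I.Boundaryless] {x₀ : N} {z : E}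
    (hz : z ∈ (extChartAt I x₀).target) (a : E) :
    ContMDiffAt 𝓘(ℝ, E) I.tangent ∞
      (fun z : E => (⟨(extChartAt I x₀).symm z, frame I x₀ z a⟩ : TangentBundle I N)) z := by
  have h1 : ContMDiffAt 𝓘(ℝ, E) 𝓘(ℝ, E × E) ∞ (fun z : E => (z, a)) z :=
    (contDiff_id.prodMk contDiff_const).contMDiff.contMDiffAt
  exact ContMDiffAt.comp z (contMDiffAt_frame (I := I) (y := (z, a)) hz) h1

namespace PseudoRiemannianMetric

variable (g : PseudoRiemannianMetric I N)

/-- The value of the metric at a point, as a bilinear form on the model space. -/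
def form (x : N) : E →L[ℝ] E →L[ℝ] ℝ := g.val x

/-- The metric in the coordinates of the preferred chart at `x₀`. -/
def coord (x₀ : N) (z : E) : E →L[ℝ] E →L[ℝ] ℝ :=
  (g.form ((extChartAt I x₀).symm z)).bilinearComp (frame I x₀ z) (frame I x₀ z)

theorem coord_apply (x₀ : N) (z a b : E) :
    g.coord x₀ z a b = g.form ((extChartAt I x₀).symm z) (frame I x₀ z a) (frame I x₀ z b) := rfl

theorem coord_self (x : N) : g.coord x (extChartAt I x x) = g.form x := by
  ext a b
  rw [coord_apply, frame_self, extChartAt_to_inv]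
  rfl

theorem form_symm (x : N) (a b : E) : g.form x a b = g.form x b a := g.symm x a b

theorem coord_symm (x₀ : N) (z a b : E) : g.coord x₀ z a b = g.coord x₀ z b a := by
  rw [coord_apply, coord_apply, form_symm]

theorem form_nondegenerate (x : N) (v : E) (hv : ∀ w, g.form x v w = 0) : v = 0 :=
  g.nondegenerate x v hv

theorem coord_transition [I.Boundaryless] {x₀ x₁ : N} {z : E} (hz : z ∈ (extChartAt I x₀).target)
    (hz' : (extChartAt I x₀).symm z ∈ (extChartAt I x₁).source) (a b : E) :
    g.coord x₀ z a b = g.coord x₁ (transition I x₀ x₁ z) (fderiv ℝ (transition I x₀ x₁) z a)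
      (fderiv ℝ (transition I x₀ x₁) z b) := by
  rw [coord_apply, coord_apply, frame_transition hz hz']
  simp only [transition, Function.comp_apply, (extChartAt I x₁).left_inv hz',
    ContinuousLinearMap.comp_apply]

/-- On the target of the chart the frame is invertible, its inverse being the opposite change of
coordinates, so nondegeneracy passes from the tangent space to the coefficients. -/
theorem coord_nondegenerate {x₀ : N} {z : E} (hz : z ∈ (extChartAt I x₀).target) (v : E)
    (hv : ∀ w, g.coord x₀ z v w = 0) : v = 0 := by
  set x := (extChartAt I x₀).symm z with hx
  have hxs : x ∈ (extChartAt I x₀).source := (extChartAt I x₀).map_target hz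
  have h1 : frame I x₀ z v = 0 := by
    refine g.form_nondegenerate x _ fun w => ?_
    have h2 := hv (tangentCoordChange I x x₀ x w)
    rw [coord_apply, ← hx] at h2
    simp only [frame, ← hx] at h2 ⊢
    rwa [tangentCoordChange_comp ⟨⟨mem_extChartAt_source x, hxs⟩, mem_extChartAt_source x⟩,
      tangentCoordChange_self (mem_extChartAt_source x)] at h2
  have h3 : tangentCoordChange I x x₀ x (frame I x₀ z v) = v := by
    simp only [frame, ← hx]
    rw [tangentCoordChange_comp ⟨⟨hxs, mem_extChartAt_source x⟩, hxs⟩,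
      tangentCoordChange_self hxs]
  rw [← h3, h1, map_zero]

/-- In finite dimension smoothness of a field of bilinear forms can be tested on pairs of constant
vectors, which turns the claim into smoothness of a scalar product of two fields. -/
theorem contDiffAt_coord [I.Boundaryless] [FiniteDimensional ℝ E] {x₀ : N} {z : E}
    (hz : z ∈ (extChartAt I x₀).target) : ContDiffAt ℝ ∞ (g.coord x₀) z := by
  have : ContDiffOn ℝ ∞ (g.coord x₀) (extChartAt I x₀).target := by
    refine contDiffOn_clm_apply.mpr fun a => contDiffOn_clm_apply.mpr fun b => ?_
    intro y hy
    have := (g.contMDiffAt_val (contMDiffAt_frame_const hy a)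
      (contMDiffAt_frame_const hy b)).contDiffAt
    exact this.contDiffWithinAt
  exact this.contDiffAt (extChartAt_target_mem_nhds_of_mem hz)

end PseudoRiemannianMetric

namespace HorizontalForm

/-- The value of a horizontal form, as a covector on the model space. -/
def covec (α : HorizontalForm I N) (v : TangentBundle I N) : E →L[ℝ] ℝ := α v

/-- A horizontal form in the coordinates of the preferred charts. -/
def coord (α : HorizontalForm I N) (x₀ : N) (y : E × E) : E →L[ℝ] ℝ :=
  (α.covec ⟨(extChartAt I x₀).symm y.1, frame I x₀ y.1 y.2⟩).comp (frame I x₀ y.1)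

theorem coord_apply (α : HorizontalForm I N) (x₀ : N) (y : E × E) (a : E) :
    α.coord x₀ y a = α.covec ⟨(extChartAt I x₀).symm y.1, frame I x₀ y.1 y.2⟩
      (frame I x₀ y.1 a) := rfl

theorem coord_self (α : HorizontalForm I N) (v : TangentBundle I N) :
    α.coord v.proj (extChartAt I.tangent v v) = α.covec v := by
  ext a
  rw [coord_apply, extChartAt_tangent_self]
  simp only
  rw [frame_self, extChartAt_to_inv]
  rfl

theorem coord_transition [I.Boundaryless] (α : HorizontalForm I N) {x₀ x₁ : N} {y : E × E}
    (hy : y.1 ∈ (extChartAt I x₀).target)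
    (hy' : (extChartAt I x₀).symm y.1 ∈ (extChartAt I x₁).source) (a : E) :
    α.coord x₀ y a = α.coord x₁
      (transition I x₀ x₁ y.1, fderiv ℝ (transition I x₀ x₁) y.1 y.2)
      (fderiv ℝ (transition I x₀ x₁) y.1 a) := by
  have h : ∀ {p q : N}, p = q → ∀ e b : E, α.covec ⟨p, e⟩ b = α.covec ⟨q, e⟩ b := by
    rintro p _ rfl e b
    rfl
  rw [coord_apply, coord_apply, frame_transition hy hy']
  exact h ((extChartAt I x₁).left_inv hy').symm _ _

/-- Smoothness of a horizontal form. -/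
def IsSmooth (α : HorizontalForm I N) : Prop :=
  ∀ (x₀ : N) (y : E × E), y.1 ∈ (extChartAt I x₀).target → ContDiffAt ℝ ∞ (α.coord x₀) y

theorem isSmooth_zero : IsSmooth (I := I) (N := N) fun _ => 0 := by
  intro x₀ y _
  have : coord (I := I) (N := N) (fun _ => 0) x₀ = fun _ => 0 := by
    funext y
    rfl
  rw [this]
  exact contDiffAt_const

end HorizontalForm

end Coordinates

/-! ### The double tangent bundle and exterior derivatives of horizontal forms -/

section Newton

variable {E : Type*} [NormedAddCommGroup E] [NormedSpace ℝ E]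
  {H : Type*} [TopologicalSpace H] {I : ModelWithCorners ℝ E H}
  {N : Type*} [TopologicalSpace N] [ChartedSpace H N] [IsManifold I ∞ N] [I.Boundaryless]

/-- For a second order vector `ξ = (e, b)` at velocity `e`, the second component is the
transformation law of accelerations appearing in `accelForm_pullback`. -/
theorem fderiv_transition_tangent (v₀ v₁ : TangentBundle I N) {y : E × E}
    (hy : y.1 ∈ (extChartAt I v₀.proj).target)
    (hy' : (extChartAt I v₀.proj).symm y.1 ∈ (extChartAt I v₁.proj).source) (ξ : E × E) :
    fderiv ℝ (transition I.tangent v₀ v₁) y ξ = (fderiv ℝ (transition I v₀.proj v₁.proj) y.1 ξ.1,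
      fderiv ℝ (fderiv ℝ (transition I v₀.proj v₁.proj)) y.1 ξ.1 y.2 +
        fderiv ℝ (transition I v₀.proj v₁.proj) y.1 ξ.2) := by
  set κ := transition I v₀.proj v₁.proj with hκ
  have hc : ContDiffAt ℝ ∞ κ y.1 := contDiffAt_transition hy hy'
  have hk : HasFDerivAt κ (fderiv ℝ κ y.1) y.1 :=
    (hc.differentiableAt (by simp)).hasFDerivAt
  have hd : HasFDerivAt (fderiv ℝ κ) (fderiv ℝ (fderiv ℝ κ) y.1) y.1 :=
    ((hc.fderiv_right (m := 1) (by norm_cast)).differentiableAt one_ne_zero).hasFDerivAt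
  have h : transition I.tangent v₀ v₁ =ᶠ[nhds y] fun y => (κ y.1, fderiv ℝ κ y.1 y.2) := by
    filter_upwards [(continuous_fst.tendsto y).eventually (eventually_mem_source_symm hy hy')]
      with z hz
    exact transition_tangent_apply v₀ v₁ hz.1 hz.2
  have h1 := (hk.comp y hasFDerivAt_fst).prodMk
    ((hd.comp y hasFDerivAt_fst).clm_apply hasFDerivAt_snd)
  rw [h.fderiv_eq]
  refine (congrArg (fun L : E × E →L[ℝ] E × E => L ξ) h1.fderiv).trans ?_
  simp [add_comm]

theorem frame_tangent_fst (v : TangentBundle I N) {y : E × E}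
    (hy : y.1 ∈ (extChartAt I v.proj).target) (ξ : E × E) :
    (frame I.tangent v y ξ).1 = frame I v.proj y.1 ξ.1 := by
  have ht : y ∈ (extChartAt I.tangent v).target := by
    rw [extChartAt_tangent_target]; exact ⟨hy, mem_univ _⟩
  set u := (extChartAt I.tangent v).symm y with hu
  have hup : u.proj = (extChartAt I v.proj).symm y.1 := by
    rw [hu, extChartAt_tangent_symm_apply v hy]
  have h1 : (extChartAt I v.proj).symm y.1 ∈ (extChartAt I u.proj).source := by
    rw [← hup]; exact mem_extChartAt_source _
  have h2 : frame I.tangent v y ξ = fderiv ℝ (transition I.tangent v u) y ξ := by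
    rw [frame, ← hu, tangentCoordChange_def, I.tangent.range_eq_univ, fderivWithin_univ, hu,
      (extChartAt I.tangent v).right_inv ht]
    rfl
  rw [h2, fderiv_transition_tangent v u hy h1, frame_transition hy h1]
  simp only [transition, Function.comp_apply, ← hup, frame_self, ContinuousLinearMap.comp_apply]
  rfl

theorem projDeriv_apply (v : TangentBundle I N) (ξ : E × E) :
    (projDeriv I N v : E × E →L[ℝ] E) ξ = ξ.1 := by
  have : mfderiv I.tangent I (fun u : TangentBundle I N => u.proj) v =
      ContinuousLinearMap.fst ℝ E E := by
    refine mfderiv_eq_of_hasFDerivAt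
      (contMDiff_proj (IB := I) (n := ∞) (TangentSpace I : N → Type _)).continuous.continuousAt
      hasFDerivAt_fst ?_
    have ht := extChartAt_target_mem_nhds_of_mem (mem_extChartAt_target (I := I.tangent) v)
    filter_upwards [ht] with y hy
    rw [extChartAt_tangent_target] at hy
    simp only [writtenInExtChartAt, Function.comp_apply]
    rw [extChartAt_tangent_symm_apply v hy.1]
    exact (extChartAt I v.proj).right_inv hy.1
  exact congrArg (fun L : E × E →L[ℝ] E => L ξ) this

theorem HorizontalForm.toOneForm_apply (α : HorizontalForm I N) (v : TangentBundle I N)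
    (ξ : E × E) : (α.toOneForm v : E × E →L[ℝ] ℝ) ξ = α.covec v ξ.1 := by
  rw [← projDeriv_apply v ξ]
  rfl

/-- A horizontal form in the preferred chart of `TN`. -/
theorem HorizontalForm.toOneForm_comp_frame (α : HorizontalForm I N) (v : TangentBundle I N)
    {y : E × E} (hy : y.1 ∈ (extChartAt I v.proj).target) (ξ : E × E) :
    (α.toOneForm ((extChartAt I.tangent v).symm y) : E × E →L[ℝ] ℝ) (frame I.tangent v y ξ) =
      α.coord v.proj y ξ.1 := by
  rw [HorizontalForm.toOneForm_apply, frame_tangent_fst v hy, extChartAt_tangent_symm_apply v hy,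
    HorizontalForm.coord_apply]

/-- Near the centre of the chart the form reads `α_i(x, e) dx^i`, since horizontal forms see only
the first component; the chart has identity derivative at its own centre. -/
theorem extDerivOneForm_toOneForm (α : HorizontalForm I N) (v : TangentBundle I N) (ξ ζ : E × E) :
    extDerivOneForm α.toOneForm v ξ ζ =
      fderiv ℝ (fun y : E × E => (α.coord v.proj y).comp (ContinuousLinearMap.fst ℝ E E))
        (extChartAt I.tangent v v) ξ ζ -
      fderiv ℝ (fun y : E × E => (α.coord v.proj y).comp (ContinuousLinearMap.fst ℝ E E))
        (extChartAt I.tangent v v) ζ ξ := by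
  let φ := extChartAt I.tangent v
  let dφ : E × E →L[ℝ] E × E := mvfderiv I.tangent φ v
  have h1 : ∀ ξ : E × E, dφ ξ = ξ := fun ξ =>
    congrArg (fun L : E × E →L[ℝ] E × E => L ξ) (mfderiv_extChartAt_self (I := I.tangent))
  let η : E × E → E × E →L[ℝ] ℝ := fun y => (α.toOneForm (φ.symm y)).comp
    (mfderivWithin 𝓘(ℝ, E × E) I.tangent φ.symm (range I.tangent) y)
  have h2 : η =ᶠ[nhds (φ v)]
      fun y : E × E => (α.coord v.proj y).comp (ContinuousLinearMap.fst ℝ E E) := by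
    have ht := extChartAt_target_mem_nhds_of_mem (mem_extChartAt_target (I := I.tangent) v)
    filter_upwards [ht] with y hy
    simp only [η]
    rw [← frame_eq_mfderivWithin hy]
    rw [extChartAt_tangent_target] at hy
    exact ContinuousLinearMap.ext fun ξ => α.toOneForm_comp_frame v hy.1 ξ
  have h3 : extDerivOneForm α.toOneForm v ξ ζ =
      fderivWithin ℝ η (range I.tangent) (φ v) (dφ ξ) (dφ ζ) -
      fderivWithin ℝ η (range I.tangent) (φ v) (dφ ζ) (dφ ξ) := rfl
  rw [h3, h1, h1, I.tangent.range_eq_univ, fderivWithin_univ, h2.fderiv_eq]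

end Newton

/-! ### Existence, uniqueness and smoothness of the equation of motion -/

section Motion

variable {E : Type*} [NormedAddCommGroup E] [NormedSpace ℝ E] [FiniteDimensional ℝ E]
  {H : Type*} [TopologicalSpace H] {I : ModelWithCorners ℝ E H}
  {N : Type*} [TopologicalSpace N] [ChartedSpace H N] [IsManifold I ∞ N] [I.Boundaryless]

namespace PseudoRiemannianMetric

variable (g : PseudoRiemannianMetric I N)

theorem differentiableAt_coord (x : N) :
    DifferentiableAt ℝ (g.coord x) (extChartAt I x x) :=
  (g.contDiffAt_coord (mem_extChartAt_target x)).differentiableAt (by simp)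

omit [FiniteDimensional ℝ E] [I.Boundaryless] in
theorem liouville_coord (x₀ : N) (y : E × E) : g.liouville.coord x₀ y = g.coord x₀ y.1 y.2 := by
  ext a
  rfl

theorem omega_eq (v : TangentBundle I N) (ξ ζ : E × E) :
    g.omega v ξ ζ =
      fderiv ℝ (g.coord v.proj) (extChartAt I v.proj v.proj) ξ.1 (components v) ζ.1 +
        g.form v.proj ξ.2 ζ.1 -
      (fderiv ℝ (g.coord v.proj) (extChartAt I v.proj v.proj) ζ.1 (components v) ξ.1 +
        g.form v.proj ζ.2 ξ.1) := by
  set G := g.coord v.proj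
  have hG : HasFDerivAt G (fderiv ℝ G (extChartAt I v.proj v.proj))
      (extChartAt I.tangent v v).1 := by
    rw [extChartAt_tangent_self]
    exact (g.differentiableAt_coord v.proj).hasFDerivAt
  have h1 := ((hG.comp _ hasFDerivAt_fst).clm_apply hasFDerivAt_snd).clm_comp
    (hasFDerivAt_const (ContinuousLinearMap.fst ℝ E E) (extChartAt I.tangent v v))
  have h2 : (fun y : E × E =>
      (g.liouville.coord v.proj y).comp (ContinuousLinearMap.fst ℝ E E)) =
      fun y => ((G ∘ Prod.fst) y y.2).comp (ContinuousLinearMap.fst ℝ E E) := by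
    funext y
    rw [liouville_coord]
    rfl
  have h3 : ∀ ξ ζ : E × E, fderiv ℝ (fun y : E × E =>
      (g.liouville.coord v.proj y).comp (ContinuousLinearMap.fst ℝ E E))
        (extChartAt I.tangent v v) ξ ζ = 
      fderiv ℝ G (extChartAt I v.proj v.proj) ξ.1 (components v) ζ.1 + g.form v.proj ξ.2 ζ.1 := by
    intro ξ ζ
    rw [h2]
    refine (congrArg (fun L : E × E →L[ℝ] E × E →L[ℝ] ℝ => L ξ ζ) h1.fderiv).trans ?_
    rw [extChartAt_tangent_self, ← g.coord_self]
    generalize extChartAt I v.proj v.proj = x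
    simp [G, add_comm]
  have h4 : g.omega v ξ ζ = extDerivOneForm g.liouville.toOneForm v ξ ζ := rfl
  rw [h4, extDerivOneForm_toOneForm, h3, h3]

theorem mvfderiv_kinetic (v : TangentBundle I N) (ξ : E × E) :
    mvfderiv I.tangent g.kinetic v ξ =
      1 / 2 * fderiv ℝ (g.coord v.proj) (extChartAt I v.proj v.proj) ξ.1 (components v) (components v) +
        g.form v.proj (components v) ξ.2 := by
  set G := g.coord v.proj
  have hG : HasFDerivAt G (fderiv ℝ G (extChartAt I v.proj v.proj))
      (extChartAt I.tangent v v).1 := by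
    rw [extChartAt_tangent_self]
    exact (g.differentiableAt_coord v.proj).hasFDerivAt
  have h1 := (((hG.comp _ hasFDerivAt_fst).clm_apply hasFDerivAt_snd).clm_apply
    hasFDerivAt_snd).const_mul (1 / 2 : ℝ)
  have h2 : g.kinetic ∘ (extChartAt I.tangent v).symm =ᶠ[nhds (extChartAt I.tangent v v)]
      fun y => 1 / 2 * (G ∘ Prod.fst) y y.2 y.2 := by
    have ht := extChartAt_target_mem_nhds_of_mem (mem_extChartAt_target (I := I.tangent) v)
    filter_upwards [ht] with y hy
    rw [extChartAt_tangent_target] at hy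
    rw [Function.comp_apply, extChartAt_tangent_symm_apply v hy.1]
    rfl
  refine (mvfderiv_apply_of_hasFDerivAt (h1.congr_of_eventuallyEq h2) ξ).trans ?_
  rw [extChartAt_tangent_self, ← g.coord_self]
  generalize extChartAt I v.proj v.proj = x
  simp [G, g.coord_symm v.proj x (components v) ξ.2]
  ring

/-- Newton's equation for a second order field, in the preferred chart. -/
theorem newtonForm_eq (α : HorizontalForm I N) (D : FieldOnTangent I N) (v : TangentBundle I N)
    (b : E) (hD : (D v : E × E) = (components v, b)) (ξ : E × E) :
    g.newtonForm α D v ξ =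
      accelForm (g.coord v.proj) (extChartAt I v.proj v.proj) (components v) b ξ.1 + α.covec v ξ.1 := by
  have h1 : g.omega v (D v) ξ = g.omega v ((components v, b) : E × E) ξ :=
    congrArg (fun η : E × E => g.omega v η ξ) hD
  have h2 : (α.toOneForm v : E × E →L[ℝ] ℝ) ξ = α.covec v ξ.1 := α.toOneForm_apply v ξ
  refine (congrArg₂ (· + ·) (congrArg₂ (· + ·) (h1.trans (g.omega_eq v _ ξ))
    (g.mvfderiv_kinetic v ξ)) h2).trans ?_
  -- The vertical component `ξ.2` enters `ω₂` and `dT` through `∓ G(e, ξ.2)`; the two terms cancel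
  -- because the first component of `D v` is the velocity. The terms in `DG(ξ.1)(e, e)` add up to
  -- `-1 + ½ = -½`.
  rw [accelForm, coord_self, g.form_symm v.proj ξ.2]
  ring

/-- The acceleration that a force `α` produces, in the preferred chart. -/
def accelerationAt (α : HorizontalForm I N) (v : TangentBundle I N) : E :=
  acceleration (g.coord v.proj) (extChartAt I v.proj v.proj) (components v) (α.covec v)

theorem newtonForm_eq_zero_iff (α : HorizontalForm I N) (D : FieldOnTangent I N)
    (v : TangentBundle I N) (b : E) (hD : (D v : E × E) = (components v, b)) :
    (∀ ξ, g.newtonForm α D v ξ = 0) ↔ b = g.accelerationAt α v := by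
  rw [accelerationAt, ← accelForm_add_eq_zero_iff
    (g.coord_nondegenerate (mem_extChartAt_target v.proj))]
  constructor
  · intro h a
    exact (g.newtonForm_eq α D v b hD (a, 0)).symm.trans (h ((a, 0) : E × E))
  · intro h ξ
    exact (g.newtonForm_eq α D v b hD ξ).trans (h _)

/-- The second order field that satisfies Newton's equation. -/
def motion (α : HorizontalForm I N) : FieldOnTangent I N := fun v =>
  ((components v, g.accelerationAt α v) : E × E)

/-- The acceleration at `v` is defined in the chart centred at `v`. Covariance of Newton's equation
shows that, moved to a fixed chart at `v₀`, it solves the same equation there, and the solution is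
unique. -/
theorem acceleration_transition {α : HorizontalForm I N} (v v₀ : TangentBundle I N)
    (h : v.proj ∈ (extChartAt I v₀.proj).source) :
    fderiv ℝ (transition I.tangent v v₀) (extChartAt I.tangent v v) (components v, g.accelerationAt α v) =
      ((extChartAt I.tangent v₀ v).2, acceleration (g.coord v₀.proj) (extChartAt I.tangent v₀ v).1
        (extChartAt I.tangent v₀ v).2 (α.coord v₀.proj (extChartAt I.tangent v₀ v))) := by
  set x := extChartAt I v.proj v.proj with hx
  set κ := transition I v.proj v₀.proj with hκ
  have hxt : x ∈ (extChartAt I v.proj).target := mem_extChartAt_target v.proj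
  have hxs : (extChartAt I v.proj).symm x ∈ (extChartAt I v₀.proj).source := by
    rwa [hx, extChartAt_to_inv]
  have hκx : κ x ∈ (extChartAt I v₀.proj).target := (extChartAt I v₀.proj).map_source hxs
  have hv : extChartAt I.tangent v₀ v = (κ x, fderiv ℝ κ x (components v)) := by
    have := transition_tangent_apply (I := I) v v₀ (y := extChartAt I.tangent v v)
      (by rw [extChartAt_tangent_self]; exact hxt) (by rw [extChartAt_tangent_self]; exact hxs)
    rw [transition, Function.comp_apply, extChartAt_to_inv] at this
    rw [this, extChartAt_tangent_self]
  rw [fderiv_transition_tangent v v₀ (by rw [extChartAt_tangent_self]; exact hxt)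
    (by rw [extChartAt_tangent_self]; exact hxs), hv, extChartAt_tangent_self]
  refine Prod.ext rfl ?_
  simp only
  have hE : ∀ᶠ y in nhds x, ∀ a b, g.coord v.proj y a b =
      g.coord v₀.proj (κ y) (fderiv ℝ κ y a) (fderiv ℝ κ y b) := by
    filter_upwards [eventually_mem_source_symm hxt hxs] with y hy a b
    exact g.coord_transition hy.1 hy.2 a b
  have hp := accelForm_pullback (g.differentiableAt_coord v.proj)
    ((g.contDiffAt_coord hκx).differentiableAt (by simp)) (contDiffAt_transition hxt hxs)
    (g.coord_symm v₀.proj (κ x)) hE (components v)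
  rw [← accelForm_add_eq_zero_iff (g.coord_nondegenerate hκx)]
  have h0 := (accelForm_add_eq_zero_iff (g.coord_nondegenerate hxt) (components v) _ (α.covec v)).mpr
    (rfl : g.accelerationAt α v = _)
  intro a'
  -- Every test vector in the new chart is the image of one in the old chart.
  obtain ⟨a, rfl⟩ := fderiv_transition_surjective hxt hxs a'
  rw [← hp, ← h0 a]
  congr 1
  have := α.coord_transition (y := extChartAt I.tangent v v) (x₀ := v.proj) (x₁ := v₀.proj)
    (by rw [extChartAt_tangent_self]; exact hxt) (by rw [extChartAt_tangent_self]; exact hxs) a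
  rw [α.coord_self, extChartAt_tangent_self] at this
  exact this.symm

/-- The definition of `motion` uses a chart varying with `v`, which hides its smoothness. By
`acceleration_transition` it is given near `v₀` by one smooth formula in the fixed chart at `v₀`. -/
theorem isSecondOrder_motion {α : HorizontalForm I N} (hα : α.IsSmooth) :
    IsSecondOrder (g.motion α) where
  proj v := projDeriv_apply v _
  contMDiff := by
    intro v₀
    rw [contMDiffAt_section]
    let F : E × E → E × E := fun y => (y.2, acceleration (g.coord v₀.proj) y.1 y.2
      (α.coord v₀.proj y))
    have hy := mem_extChartAt_target (I := I.tangent) v₀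
    rw [extChartAt_tangent_target] at hy
    have hF : ContDiffAt ℝ ∞ F (extChartAt I.tangent v₀ v₀) :=
      contDiffAt_snd.prodMk (contDiffAt_acceleration (g.contDiffAt_coord hy.1)
        (g.coord_nondegenerate hy.1) contDiffAt_fst contDiffAt_snd (hα _ _ hy.1))
    refine (hF.contMDiffAt.comp v₀ contMDiffAt_extChartAt).congr_of_eventuallyEq ?_
    filter_upwards [extChartAt_source_mem_nhds (I := I.tangent) v₀] with v hv
    have hv' : v.proj ∈ (extChartAt I v₀.proj).source := by
      simpa [extChartAt_source] using hv
    refine Eq.trans ?_ (g.acceleration_transition v v₀ hv')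
    rw [← fderivWithin_univ, ← I.tangent.range_eq_univ]
    rfl

theorem isEquationOfMotion_motion {α : HorizontalForm I N} (hα : α.IsSmooth) :
    IsEquationOfMotion g α (g.motion α) where
  toIsSecondOrder := g.isSecondOrder_motion hα
  newton v := (g.newtonForm_eq_zero_iff α (g.motion α) v (g.accelerationAt α v) rfl).mpr rfl

omit [FiniteDimensional ℝ E] in
theorem _root_.Mechanics.IsSecondOrder.eq_mk {D : FieldOnTangent I N} (hD : IsSecondOrder D)
    (v : TangentBundle I N) : (D v : E × E) = (components v, (D v : E × E).2) :=
  Prod.ext ((projDeriv_apply v (D v)).symm.trans (hD.proj v)) rfl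

theorem eq_motion_of_isEquationOfMotion {α : HorizontalForm I N} {D : FieldOnTangent I N}
    (hD : IsEquationOfMotion g α D) : D = g.motion α := by
  funext v
  have h := hD.toIsSecondOrder.eq_mk v
  have h1 := (g.newtonForm_eq_zero_iff α D v _ h).mp (hD.newton v)
  rw [h1] at h
  exact h

theorem existsUnique_isEquationOfMotion {α : HorizontalForm I N} (hα : α.IsSmooth) :
    ∃! D, IsEquationOfMotion g α D :=
  ⟨_, g.isEquationOfMotion_motion hα, fun _ hD => g.eq_motion_of_isEquationOfMotion hD⟩

end PseudoRiemannianMetric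

end Motion

/-! ### Differentials of functions and a smoothness criterion for bilinear forms -/

section Functions

variable {E : Type*} [NormedAddCommGroup E] [NormedSpace ℝ E]
  {H : Type*} [TopologicalSpace H] {I : ModelWithCorners ℝ E H}
  {N : Type*} [TopologicalSpace N] [ChartedSpace H N] [IsManifold I ∞ N] [I.Boundaryless]

variable (I) in
/-- The differential of a function at a point, as a covector on the model space. -/
def differential (f : N → ℝ) (x : N) : E →L[ℝ] ℝ := mvfderiv I f x

omit [IsManifold I ∞ N] in
theorem hasFDerivAt_differential {f : N → ℝ} {x : N} (hf : MDifferentiableAt I 𝓘(ℝ, ℝ) f x) :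
    HasFDerivAt (f ∘ (extChartAt I x).symm) (differential I f x) (extChartAt I x x) := by
  have h : HasFDerivWithinAt (f ∘ (extChartAt I x).symm) (differential I f x) (range I)
    (extChartAt I x x) := hf.hasMFDerivAt.2
  rwa [I.range_eq_univ, hasFDerivWithinAt_univ] at h

omit [IsManifold I ∞ N] in
theorem differential_eq_of_hasFDerivAt {f : N → ℝ} {x : N} {f' : E →L[ℝ] ℝ}
    (h : HasFDerivAt (f ∘ (extChartAt I x).symm) f' (extChartAt I x x)) :
    differential I f x = f' :=
  ContinuousLinearMap.ext fun a => mvfderiv_apply_of_hasFDerivAt h a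

/-- The function in the chart at `x₀` is the function in the chart at the point itself, composed
with the transition; the chain rule and `frame_transition` then agree. -/
theorem differential_frame {f : N → ℝ} (hf : ContMDiff I 𝓘(ℝ, ℝ) ∞ f) {x₀ : N} {z : E}
    (hz : z ∈ (extChartAt I x₀).target) (a : E) :
    differential I f ((extChartAt I x₀).symm z) (frame I x₀ z a) =
      fderiv ℝ (f ∘ (extChartAt I x₀).symm) z a := by
  set x := (extChartAt I x₀).symm z with hx
  have hs : (extChartAt I x₀).symm z ∈ (extChartAt I x).source := mem_extChartAt_source x
  have h1 : f ∘ (extChartAt I x₀).symm =ᶠ[nhds z]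
      (f ∘ (extChartAt I x).symm) ∘ transition I x₀ x := by
    filter_upwards [eventually_mem_source_symm hz hs] with y hy
    simp only [Function.comp_apply, transition, (extChartAt I x).left_inv hy.2]
  have h2 := hasFDerivAt_differential ((hf x).mdifferentiableAt (by simp))
  have h3 := h2.comp z (f := transition I x₀ x) (by
    exact ((contDiffAt_transition hz hs).differentiableAt (by simp)).hasFDerivAt)
  rw [h1.fderiv_eq, h3.fderiv, frame_transition hz hs]
  simp only [transition, Function.comp_apply, ContinuousLinearMap.comp_apply]
  rw [← hx, frame_self]
  rfl

theorem contDiffAt_comp_symm {f : N → ℝ} (hf : ContMDiff I 𝓘(ℝ, ℝ) ∞ f) {x₀ : N} {z : E}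
    (hz : z ∈ (extChartAt I x₀).target) : ContDiffAt ℝ ∞ (f ∘ (extChartAt I x₀).symm) z :=
  (hf.contMDiffAt.comp z ((contMDiffOn_extChartAt_symm x₀).contMDiffAt
    (extChartAt_target_mem_nhds_of_mem hz))).contDiffAt

/-- The differential of a function is a smooth horizontal form. -/
theorem isSmooth_ofBase_mvfderiv {f : N → ℝ} (hf : ContMDiff I 𝓘(ℝ, ℝ) ∞ f) :
    (HorizontalForm.ofBase fun x => mvfderiv I f x).IsSmooth := by
  intro x₀ y hy
  have h : ContDiffAt ℝ ∞ (fun y : E × E => fderiv ℝ (f ∘ (extChartAt I x₀).symm) y.1) y :=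
    ((contDiffAt_comp_symm hf hy).fderiv_right (m := ∞) le_rfl).comp y contDiffAt_fst
  refine h.congr_of_eventuallyEq ?_
  filter_upwards [(continuous_fst.tendsto y).eventually (extChartAt_target_mem_nhds_of_mem hy)]
    with z hz
  ext a
  rw [HorizontalForm.coord_apply]
  exact differential_frame hf hz a

/-- A field of bilinear forms is smooth if its coefficients in the preferred charts are smooth. -/
theorem contMDiff_bilinear_of_coord [FiniteDimensional ℝ E]
    (B : ∀ x : N, TangentSpace I x →L[ℝ] TangentSpace I x →L[ℝ] ℝ)
    (B' : N → E →L[ℝ] E →L[ℝ] ℝ) (h : ∀ (x : N) (a b : TangentSpace I x), B x a b = B' x a b)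
    (hB : ∀ (x₀ : N) (a b : E), ContDiffOn ℝ ∞ (fun z =>
      B' ((extChartAt I x₀).symm z) (frame I x₀ z a) (frame I x₀ z b))
      (extChartAt I x₀).target) :
    ContMDiff I (I.prod 𝓘(ℝ, E →L[ℝ] E →L[ℝ] ℝ)) ∞
      (fun x => TotalSpace.mk' (E →L[ℝ] E →L[ℝ] ℝ)
        (E := fun x : N => TangentSpace I x →L[ℝ] TangentSpace I x →L[ℝ] ℝ) x (B x)) := by
  intro x₀
  rw [contMDiffAt_section]
  let C : E → E →L[ℝ] E →L[ℝ] ℝ := fun z =>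
    (B' ((extChartAt I x₀).symm z)).bilinearComp (frame I x₀ z) (frame I x₀ z)
  have hC : ContDiffAt ℝ ∞ C (extChartAt I x₀ x₀) := by
    have : ContDiffOn ℝ ∞ C (extChartAt I x₀).target :=
      contDiffOn_clm_apply.mpr fun a => contDiffOn_clm_apply.mpr fun b => hB x₀ a b
    exact this.contDiffAt (extChartAt_target_mem_nhds_of_mem (mem_extChartAt_target x₀))
  refine (hC.contMDiffAt.comp x₀ contMDiffAt_extChartAt).congr_of_eventuallyEq ?_
  filter_upwards [extChartAt_source_mem_nhds (I := I) x₀] with x hx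
  have hx' : x ∈ (chartAt H x₀).source := by simpa using hx
  refine ContinuousLinearMap.ext fun a => ContinuousLinearMap.ext fun b => ?_
  rw [hom_trivializationAt_apply]
  have h1 := inCoordinates_apply_eq₂ (𝕜 := ℝ) (F₁ := E) (E₁ := TangentSpace I) (F₂ := E)
    (E₂ := TangentSpace I) (F₃ := ℝ) (E₃ := fun _ : N => ℝ) (x₀ := x₀) (x := x) (ϕ := B x)
    (v := a) (w := b) (by simpa using hx') (by simpa using hx') (by simp)
  refine (h1.trans (congrArg (fun L : ℝ →ₗ[ℝ] ℝ => L _)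
    (Bundle.Trivial.linearMapAt_trivialization ℝ N ℝ x))).trans ((h x _ _).trans ?_)
  have h2 : ∀ a : E, (trivializationAt E (TangentSpace I) x₀).symm x a =
      frame I x₀ (extChartAt I x₀ x) a := by
    intro a
    have := TangentBundle.symmL_trivializationAt_eq_core (I := I) hx'
    simp only [frame, (extChartAt I x₀).left_inv hx]
    exact (Trivialization.symmL_apply (R := ℝ) _ (by simpa using hx') a).symm.trans
      (congrArg (fun L : E →L[ℝ] E => L a) this)
  rw [h2, h2]
  simp only [C, Function.comp_apply, (extChartAt I x₀).left_inv hx]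
  rfl

end Functions

/-! ### The product `W × ℝ` and its static metric -/

section StaticExtension

variable {E : Type*} [NormedAddCommGroup E] [NormedSpace ℝ E]
  {M' : Type*} [TopologicalSpace M'] [ChartedSpace E M'] (W : Opens M')

theorem extChartAt_ext_apply (z p : W × ℝ) :
    extChartAt (extModel E) z p =
      (extChartAt 𝓘(ℝ, E) (baseProj W z) (baseProj W p), timeCoord W p) := rfl

theorem mem_extChartAt_ext_source {z p : W × ℝ} :
    p ∈ (extChartAt (extModel E) z).source ↔
      baseProj W p ∈ (extChartAt 𝓘(ℝ, E) (baseProj W z)).source := by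
  rw [extChartAt_source, extChartAt_source]
  have h : (chartAt E z.1).source = Subtype.val ⁻¹' (chartAt E (baseProj W z)).source :=
    OpenPartialHomeomorph.subtypeRestr_source _ _
  have h2 : (chartAt (ModelProd E ℝ) z).source = (chartAt E z.1).source ×ˢ univ := by
    rw [prodChartedSpace_chartAt, OpenPartialHomeomorph.prod_source]
    rfl
  rw [h2, h]
  simp [baseProj]

variable {W}

/-- The inverse of the restricted chart is never unfolded: both coordinates are read off from the
right-inverse identity. -/
theorem ext_symm_eq {z : W × ℝ} {y : E × ℝ} (hy : y ∈ (extChartAt (extModel E) z).target) :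
    y.1 ∈ (extChartAt 𝓘(ℝ, E) (baseProj W z)).target ∧
      baseProj W ((extChartAt (extModel E) z).symm y) =
        (extChartAt 𝓘(ℝ, E) (baseProj W z)).symm y.1 ∧
      timeCoord W ((extChartAt (extModel E) z).symm y) = y.2 := by
  have h1 := (extChartAt (extModel E) z).right_inv hy
  have h2 := (mem_extChartAt_ext_source W).mp ((extChartAt (extModel E) z).map_target hy)
  rw [extChartAt_ext_apply] at h1
  have h3 : extChartAt 𝓘(ℝ, E) (baseProj W z)
      (baseProj W ((extChartAt (extModel E) z).symm y)) = y.1 := congrArg Prod.fst h1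
  refine ⟨?_, ?_, congrArg Prod.snd h1⟩
  · rw [← h3]
    exact (extChartAt 𝓘(ℝ, E) (baseProj W z)).map_source h2
  · rw [← h3, (extChartAt 𝓘(ℝ, E) (baseProj W z)).left_inv h2]

theorem contMDiff_baseProj : ContMDiff (extModel E) 𝓘(ℝ, E) ∞ (baseProj W) :=
  contMDiff_subtype_val.comp contMDiff_fst

theorem mfderiv_baseProj (z : W × ℝ) (v : E × ℝ) :
    (mfderiv (extModel E) 𝓘(ℝ, E) (baseProj W) z : E × ℝ →L[ℝ] E) v = v.1 := by
  have h : mfderiv (extModel E) 𝓘(ℝ, E) (baseProj W) z = ContinuousLinearMap.fst ℝ E ℝ := by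
    refine mfderiv_eq_of_hasFDerivAt (contMDiff_baseProj (E := E)).continuous.continuousAt hasFDerivAt_fst ?_
    filter_upwards [extChartAt_target_mem_nhds_of_mem (mem_extChartAt_target (I := extModel E) z)]
      with y hy
    exact congrArg Prod.fst ((extChartAt (extModel E) z).right_inv hy)
  exact congrArg (fun L : E × ℝ →L[ℝ] E => L v) h

theorem contMDiff_timeCoord : ContMDiff (extModel E) 𝓘(ℝ, ℝ) ∞ (timeCoord W) := contMDiff_snd

theorem dTime_apply (z : W × ℝ) (v : E × ℝ) : (dTime W z : E × ℝ →L[ℝ] ℝ) v = v.2 := by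
  refine mvfderiv_apply_of_hasFDerivAt (I := extModel E) (f := timeCoord W)
    (f' := ContinuousLinearMap.snd ℝ E ℝ) (x := z) ?_ v
  refine hasFDerivAt_snd.congr_of_eventuallyEq ?_
  filter_upwards [extChartAt_target_mem_nhds_of_mem (mem_extChartAt_target (I := extModel E) z)]
    with y hy
  exact (ext_symm_eq hy).2.2

theorem isHolonomic_dTime :
    IsHolonomic (I := extModel E) (HorizontalForm.ofBase (dTime (E := E) W)) :=
  ⟨timeCoord W, contMDiff_timeCoord, rfl⟩

variable [IsManifold 𝓘(ℝ, E) ∞ M']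

/-- Charts of `W × ℝ` are products of restricted charts of `M'` with the identity of `ℝ`, so their
transitions, and hence their frames, split. -/
theorem frame_ext {z : W × ℝ} {y : E × ℝ} (hy : y ∈ (extChartAt (extModel E) z).target)
    (v : E × ℝ) : frame (extModel E) z y v = (frame 𝓘(ℝ, E) (baseProj W z) y.1 v.1, v.2) := by
  set p := (extChartAt (extModel E) z).symm y with hp
  obtain ⟨h1, h2, h3⟩ := ext_symm_eq hy
  have hs : (extChartAt 𝓘(ℝ, E) (baseProj W z)).symm y.1 ∈
      (extChartAt 𝓘(ℝ, E) (baseProj W p)).source := by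
    rw [← h2]
    exact mem_extChartAt_source _
  set κ := transition 𝓘(ℝ, E) (baseProj W z) (baseProj W p) with hκ
  have h4 : transition (extModel E) z p =ᶠ[nhds y] fun y => (κ y.1, y.2) := by
    filter_upwards [extChartAt_target_mem_nhds_of_mem hy] with x hx
    obtain ⟨-, h2, h3⟩ := ext_symm_eq hx
    simp only [transition, Function.comp_apply, extChartAt_ext_apply, h2, h3, hκ]
  have hk : HasFDerivAt κ (fderiv ℝ κ y.1) y.1 :=
    ((contDiffAt_transition h1 hs).differentiableAt (by simp)).hasFDerivAt
  have h5 := ((hk.comp y hasFDerivAt_fst).prodMk hasFDerivAt_snd).congr_of_eventuallyEq h4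
  have h6 : frame (extModel E) z y v = fderiv ℝ (transition (extModel E) z p) y v := by
    rw [fderiv_transition hy]
    rfl
  rw [h6, h5.fderiv, frame_transition h1 hs]
  have h7 : κ y.1 = extChartAt 𝓘(ℝ, E) (baseProj W p) (baseProj W p) := by
    simp only [hκ, transition, Function.comp_apply, ← h2]
    rfl
  rw [ContinuousLinearMap.comp_apply, ← hκ, h7, frame_self]
  rfl

/-- The static extension of a metric by the square of `dx⁰`, at a point. -/
def staticForm (T' : PseudoRiemannianMetric 𝓘(ℝ, E) M') (f : M' → ℝ) (z : W × ℝ) :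
    E × ℝ →L[ℝ] E × ℝ →L[ℝ] ℝ :=
  f (baseProj W z) • (ContinuousLinearMap.snd ℝ E ℝ).smulRight (ContinuousLinearMap.snd ℝ E ℝ) +
    (T'.form (baseProj W z)).bilinearComp (ContinuousLinearMap.fst ℝ E ℝ)
      (ContinuousLinearMap.fst ℝ E ℝ)

theorem staticForm_apply (T' : PseudoRiemannianMetric 𝓘(ℝ, E) M') (f : M' → ℝ) (z : W × ℝ)
    (v w : E × ℝ) : staticForm T' f z v w =
      f (baseProj W z) * v.2 * w.2 + T'.form (baseProj W z) v.1 w.1 := by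
  simp [staticForm, mul_assoc]

variable [FiniteDimensional ℝ E]

/-- The static extension of a metric. -/
def staticMetric (T' : PseudoRiemannianMetric 𝓘(ℝ, E) M') (f : M' → ℝ)
    (hf : ContMDiffOn 𝓘(ℝ, E) 𝓘(ℝ, ℝ) ∞ f W) (hf0 : ∀ q ∈ W, f q ≠ 0) :
    PseudoRiemannianMetric (extModel E) (W × ℝ) where
  val z := staticForm T' f z
  symm z v w := by
    refine (staticForm_apply T' f z v w).trans (Eq.trans ?_ (staticForm_apply T' f z w v).symm)
    rw [T'.form_symm]
    ring
  nondegenerate z v hv := by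
    have h : ∀ w : E × ℝ, f (baseProj W z) * (v : E × ℝ).2 * w.2 +
        T'.form (baseProj W z) (v : E × ℝ).1 w.1 = 0 := fun w =>
      (staticForm_apply T' f z v w).symm.trans (hv w)
    refine Prod.ext (T'.form_nondegenerate (baseProj W z) _ fun w => ?_) ?_
    · simpa using h (w, 0)
    · have := h (0, 1)
      simp [hf0 _ z.1.2, baseProj] at this
      exact this
  contMDiff := by
    refine contMDiff_bilinear_of_coord _ (staticForm T' f) (fun _ _ _ => rfl) fun z v w y hy => ?_
    obtain ⟨h1, h2, -⟩ := ext_symm_eq hy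
    have h3 : ∀ᶠ y in nhds y, staticForm T' f ((extChartAt (extModel E) z).symm y)
        (frame (extModel E) z y v) (frame (extModel E) z y w) =
        (f ∘ (extChartAt 𝓘(ℝ, E) (baseProj W z)).symm) y.1 * v.2 * w.2 +
          T'.coord (baseProj W z) y.1 v.1 w.1 := by
      filter_upwards [extChartAt_target_mem_nhds_of_mem hy] with y hy
      rw [staticForm_apply, frame_ext hy, frame_ext hy, (ext_symm_eq hy).2.1]
      rfl
    have h4 : ContDiffAt ℝ ∞ (f ∘ (extChartAt 𝓘(ℝ, E) (baseProj W z)).symm) y.1 := by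
      have hW : (extChartAt 𝓘(ℝ, E) (baseProj W z)).symm y.1 ∈ (W : Set M') := by
        rw [← h2]
        exact ((extChartAt (extModel E) z).symm y).1.2
      exact ((hf.contMDiffAt (W.2.mem_nhds hW)).comp y.1
        ((contMDiffOn_extChartAt_symm (baseProj W z)).contMDiffAt
          (extChartAt_target_mem_nhds_of_mem h1))).contDiffAt
    have h5 : ContDiffAt ℝ ∞ (fun y : E × ℝ =>
        (f ∘ (extChartAt 𝓘(ℝ, E) (baseProj W z)).symm) y.1 * v.2 * w.2 +
          T'.coord (baseProj W z) y.1 v.1 w.1) y :=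
      (((h4.comp y contDiffAt_fst).mul contDiffAt_const).mul contDiffAt_const).add
        ((((T'.contDiffAt_coord h1).comp y contDiffAt_fst).clm_apply contDiffAt_const).clm_apply
          contDiffAt_const)
    exact (h5.congr_of_eventuallyEq h3).contDiffWithinAt

theorem isStaticExtension_staticMetric (T' : PseudoRiemannianMetric 𝓘(ℝ, E) M') (f : M' → ℝ)
    (hf : ContMDiffOn 𝓘(ℝ, E) 𝓘(ℝ, ℝ) ∞ f W) (hf0 : ∀ q ∈ W, f q ≠ 0) :
    IsStaticExtension T' W (fun q => f q) (staticMetric T' f hf hf0) := by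
  intro z v w
  refine (staticForm_apply T' f z v w).trans ?_
  rw [← dTime_apply z v, ← dTime_apply z w, ← mfderiv_baseProj z v, ← mfderiv_baseProj z w]
  rfl

end StaticExtension

/-! ### Newton's equation and time constraints in a static metric -/

section StaticMotion

variable {E : Type*} [NormedAddCommGroup E] [NormedSpace ℝ E]
  {M' : Type*} [TopologicalSpace M'] [ChartedSpace E M'] {W : Opens M'}

theorem tangentMap_baseProj (v : TangentBundle (extModel E) (W × ℝ)) :
    tangentMap (extModel E) 𝓘(ℝ, E) (baseProj W) v =
      ⟨baseProj W v.proj, (components v : E × ℝ).1⟩ :=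
  congrArg (fun a : E => (⟨baseProj W v.proj, a⟩ : TangentBundle 𝓘(ℝ, E) M'))
    (mfderiv_baseProj v.proj (components v))

theorem dot_smul_dTime (f : M' → ℝ) (v : TangentBundle (extModel E) (W × ℝ)) :
    (HorizontalForm.ofBase fun z : W × ℝ => f z.1 • dTime (E := E) W z).dot v =
      f (baseProj W v.proj) * (components v).2 :=
  congrArg (fun r : ℝ => f (baseProj W v.proj) * r) (dTime_apply v.proj (components v))

variable [IsManifold 𝓘(ℝ, E) ∞ M']

theorem mfderiv_tangentMap_baseProj (v : TangentBundle (extModel E) (W × ℝ))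
    (ξ : (E × ℝ) × (E × ℝ)) :
    (mfderiv (extModel E).tangent 𝓘(ℝ, E).tangent
      (tangentMap (extModel E) 𝓘(ℝ, E) (baseProj W)) v : (E × ℝ) × (E × ℝ) →L[ℝ] E × E) ξ =
      (ξ.1.1, ξ.2.1) := by
  have h : mfderiv (extModel E).tangent 𝓘(ℝ, E).tangent
      (tangentMap (extModel E) 𝓘(ℝ, E) (baseProj W)) v =
      (ContinuousLinearMap.fst ℝ E ℝ).prodMap (ContinuousLinearMap.fst ℝ E ℝ) := by
    refine mfderiv_eq_of_hasFDerivAt ((contMDiff_baseProj (E := E)).continuous_tangentMap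
      (by simp)).continuousAt (ContinuousLinearMap.hasFDerivAt _) ?_
    filter_upwards [extChartAt_target_mem_nhds_of_mem
      (mem_extChartAt_target (I := (extModel E).tangent) v)] with y hy
    rw [extChartAt_tangent_target] at hy
    obtain ⟨h1, h2, -⟩ := ext_symm_eq hy.1
    set u := tangentMap (extModel E) 𝓘(ℝ, E) (baseProj W) v with hu
    have h3 : tangentMap (extModel E) 𝓘(ℝ, E) (baseProj W)
        ((extChartAt (extModel E).tangent v).symm y) =
        (extChartAt 𝓘(ℝ, E).tangent u).symm (y.1.1, y.2.1) := by
      rw [extChartAt_tangent_symm_apply v hy.1, tangentMap_baseProj,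
        extChartAt_tangent_symm_apply u (y := (y.1.1, y.2.1)) h1]
      have h4 : (components (⟨(extChartAt (extModel E) v.proj).symm y.1,
          frame (extModel E) v.proj y.1 y.2⟩ : TangentBundle (extModel E) (W × ℝ)) : E × ℝ).1 =
          frame 𝓘(ℝ, E) (baseProj W v.proj) y.1.1 y.2.1 :=
        congrArg Prod.fst (frame_ext hy.1 y.2)
      have h5 : ∀ {p q : M'}, p = q → ∀ {a b : E}, a = b →
          (⟨p, a⟩ : TangentBundle 𝓘(ℝ, E) M') = ⟨q, b⟩ := by
        rintro p _ rfl a _ rfl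
        rfl
      exact h5 h2 h4
    simp only [writtenInExtChartAt, Function.comp_apply]
    rw [h3, ← hu]
    refine (extChartAt 𝓘(ℝ, E).tangent u).right_inv ?_
    rw [extChartAt_tangent_target]
    exact ⟨h1, mem_univ _⟩
  exact congrArg (fun L : (E × ℝ) × (E × ℝ) →L[ℝ] E × E => L ξ) h

/-- This is the product rule for `f ẋ⁰`. Along a second order field it gives `df(ẋ) ẋ⁰ + f ẍ⁰`, the
time part of the geodesic equation. -/
theorem mvfderiv_dot_smul_dTime {f : M' → ℝ} {v : TangentBundle (extModel E) (W × ℝ)}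
    (hf : MDifferentiableAt 𝓘(ℝ, E) 𝓘(ℝ, ℝ) f (baseProj W v.proj)) (ξ : (E × ℝ) × (E × ℝ)) :
    mvfderiv (extModel E).tangent
      (HorizontalForm.ofBase fun z : W × ℝ => f z.1 • dTime (E := E) W z).dot v ξ =
      differential 𝓘(ℝ, E) f (baseProj W v.proj) ξ.1.1 * (components v).2 +
        f (baseProj W v.proj) * ξ.2.2 := by
  have h1 : HasFDerivAt (f ∘ (extChartAt 𝓘(ℝ, E) (baseProj W v.proj)).symm)
      (differential 𝓘(ℝ, E) f (baseProj W v.proj)) (extChartAt (extModel E).tangent v v).1.1 := by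
    rw [extChartAt_tangent_self]
    exact hasFDerivAt_differential hf
  have h2 := (h1.comp (extChartAt (extModel E).tangent v v)
      (hasFDerivAt_fst (𝕜 := ℝ).comp (extChartAt (extModel E).tangent v v)
        (hasFDerivAt_fst (𝕜 := ℝ)))).mul
    (hasFDerivAt_snd (𝕜 := ℝ).comp (extChartAt (extModel E).tangent v v)
      (hasFDerivAt_snd (𝕜 := ℝ)))
  have h3 : (HorizontalForm.ofBase fun z : W × ℝ => f z.1 • dTime (E := E) W z).dot ∘
      (extChartAt (extModel E).tangent v).symm =ᶠ[nhds (extChartAt (extModel E).tangent v v)]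
      fun y => (f ∘ (extChartAt 𝓘(ℝ, E) (baseProj W v.proj)).symm) y.1.1 * y.2.2 := by
    filter_upwards [extChartAt_target_mem_nhds_of_mem
      (mem_extChartAt_target (I := (extModel E).tangent) v)] with y hy
    rw [extChartAt_tangent_target] at hy
    rw [Function.comp_apply, extChartAt_tangent_symm_apply v hy.1, dot_smul_dTime,
      Function.comp_apply, ← (ext_symm_eq hy.1).2.1]
    have h4 : (components (⟨(extChartAt (extModel E) v.proj).symm y.1,
        frame (extModel E) v.proj y.1 y.2⟩ : TangentBundle (extModel E) (W × ℝ)) : E × ℝ).2 =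
        y.2.2 := (congrArg Prod.snd (frame_ext hy.1 y.2)).trans rfl
    rw [h4]
  refine (mvfderiv_apply_of_hasFDerivAt (h2.congr_of_eventuallyEq h3) ξ).trans ?_
  rw [extChartAt_tangent_self]
  have h4 : (extChartAt 𝓘(ℝ, E) (baseProj W v.proj)).symm (extChartAt (extModel E) v.proj v.proj).1
      = baseProj W v.proj := extChartAt_to_inv (I := 𝓘(ℝ, E)) (baseProj W v.proj)
  simp only [Function.comp_apply, h4]
  simp
  ring

variable [FiniteDimensional ℝ E] (T' : PseudoRiemannianMetric 𝓘(ℝ, E) M')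

theorem staticMetric_coord {f : M' → ℝ} (hf : ContMDiffOn 𝓘(ℝ, E) 𝓘(ℝ, ℝ) ∞ f W)
    (hf0 : ∀ q ∈ W, f q ≠ 0) {z : W × ℝ} {y : E × ℝ}
    (hy : y ∈ (extChartAt (extModel E) z).target) (v w : E × ℝ) :
    (staticMetric T' f hf hf0).coord z y v w =
      (f ∘ (extChartAt 𝓘(ℝ, E) (baseProj W z)).symm) y.1 * v.2 * w.2 +
        T'.coord (baseProj W z) y.1 v.1 w.1 := by
  rw [PseudoRiemannianMetric.coord_apply]
  refine (staticForm_apply T' f _ _ _).trans ?_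
  rw [frame_ext hy, frame_ext hy, (ext_symm_eq hy).2.1]
  rfl

/-- The metric is block diagonal with coefficients independent of `x⁰`, so `f` contributes one term
along `dx⁰` and, through its spatial derivative, the force `-½ (ẋ⁰)² df`. -/
theorem accelForm_staticMetric {f : M' → ℝ} (hf : ContMDiffOn 𝓘(ℝ, E) 𝓘(ℝ, ℝ) ∞ f W)
    (hf0 : ∀ q ∈ W, f q ≠ 0) (z : W × ℝ) (e b a : E × ℝ) :
    accelForm ((staticMetric T' f hf hf0).coord z) (extChartAt (extModel E) z z) e b a =
      accelForm (T'.coord (baseProj W z)) (extChartAt 𝓘(ℝ, E) (baseProj W z) (baseProj W z))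
        e.1 b.1 a.1 + f (baseProj W z) * b.2 * a.2 +
      differential 𝓘(ℝ, E) f (baseProj W z) e.1 * e.2 * a.2 -
      1 / 2 * (differential 𝓘(ℝ, E) f (baseProj W z) a.1 * e.2 * e.2) := by
  have hz := mem_extChartAt_target (I := extModel E) z
  have hfd : MDifferentiableAt 𝓘(ℝ, E) 𝓘(ℝ, ℝ) f (baseProj W z) :=
    (hf.contMDiffAt (W.2.mem_nhds z.1.2)).mdifferentiableAt (by simp)
  have h1 : HasFDerivAt (f ∘ (extChartAt 𝓘(ℝ, E) (baseProj W z)).symm)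
      (differential 𝓘(ℝ, E) f (baseProj W z)) (extChartAt (extModel E) z z).1 :=
    hasFDerivAt_differential hfd
  have h2 : DifferentiableAt ℝ (T'.coord (baseProj W z)) (extChartAt (extModel E) z z).1 :=
    T'.differentiableAt_coord (baseProj W z)
  have h3 : ∀ c v w : E × ℝ, fderiv ℝ ((staticMetric T' f hf hf0).coord z)
      (extChartAt (extModel E) z z) c v w =
      differential 𝓘(ℝ, E) f (baseProj W z) c.1 * v.2 * w.2 +
      fderiv ℝ (T'.coord (baseProj W z)) (extChartAt (extModel E) z z).1 c.1 v.1 w.1 := by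
    intro c v w
    rw [← fderiv_clm_apply₂ ((staticMetric T' f hf hf0).differentiableAt_coord z)]
    have h4 : (fun y => (staticMetric T' f hf hf0).coord z y v w) =ᶠ[
        nhds (extChartAt (extModel E) z z)] fun y =>
        (f ∘ (extChartAt 𝓘(ℝ, E) (baseProj W z)).symm) y.1 * v.2 * w.2 +
          T'.coord (baseProj W z) y.1 v.1 w.1 := by
      filter_upwards [extChartAt_target_mem_nhds_of_mem hz] with y hy
      exact staticMetric_coord T' hf hf0 hy v w
    have h5 := (((h1.comp _ hasFDerivAt_fst).mul_const v.2).mul_const w.2).add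
      ((hasFDerivAt_clm_apply₂ h2 v.1 w.1).comp _ hasFDerivAt_fst)
    refine (congrArg (fun L : E × ℝ →L[ℝ] ℝ => L c)
      (h5.congr_of_eventuallyEq h4).fderiv).trans ?_
    simp
    ring
  have h6 : (f ∘ (extChartAt 𝓘(ℝ, E) (baseProj W z)).symm) (extChartAt (extModel E) z z).1 =
      f (baseProj W z) := congrArg f (extChartAt_to_inv (I := 𝓘(ℝ, E)) (baseProj W z))
  rw [accelForm, h3, h3, staticMetric_coord T' hf hf0 hz, h6, accelForm]
  simp only [extChartAt_ext_apply]
  ring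

end StaticMotion

/-! ### The holonomic and the non-holonomic time constraint -/

section TimeConstraints

variable {E : Type*} [NormedAddCommGroup E] [NormedSpace ℝ E] [FiniteDimensional ℝ E]
  {M' : Type*} [TopologicalSpace M'] [ChartedSpace E M'] [IsManifold 𝓘(ℝ, E) ∞ M'] {W : Opens M'}
  (T' : PseudoRiemannianMetric 𝓘(ℝ, E) M') {U : M' → ℝ} {D' : FieldOnTangent 𝓘(ℝ, E) M'}

omit [FiniteDimensional ℝ E] in
theorem accelForm_zero (G : E → E →L[ℝ] E →L[ℝ] ℝ) (x e b : E) : accelForm G x e b 0 = 0 := by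
  simp [accelForm]

/-- Newton's equation for a force-free static system. -/
theorem newtonForm_staticMetric {f : M' → ℝ} (hf : ContMDiffOn 𝓘(ℝ, E) 𝓘(ℝ, ℝ) ∞ f W)
    (hf0 : ∀ q ∈ W, f q ≠ 0) {D : FieldOnTangent (extModel E) (W × ℝ)} (hD : IsSecondOrder D)
    (v : TangentBundle (extModel E) (W × ℝ)) (ξ : (E × ℝ) × (E × ℝ)) :
    (staticMetric T' f hf hf0).newtonForm (fun _ => 0) D v ξ =
      accelForm (T'.coord (baseProj W v.proj))
        (extChartAt 𝓘(ℝ, E) (baseProj W v.proj) (baseProj W v.proj))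
        (components v).1 (D v : (E × ℝ) × (E × ℝ)).2.1 ξ.1.1 +
      f (baseProj W v.proj) * (D v : (E × ℝ) × (E × ℝ)).2.2 * ξ.1.2 +
      differential 𝓘(ℝ, E) f (baseProj W v.proj) (components v).1 * (components v).2 * ξ.1.2 -
      1 / 2 * (differential 𝓘(ℝ, E) f (baseProj W v.proj) ξ.1.1 * (components v).2 *
        (components v).2) := by
  refine ((staticMetric T' f hf hf0).newtonForm_eq (fun _ => 0) D v _ (hD.eq_mk v) ξ).trans ?_
  rw [accelForm_staticMetric]
  exact add_zero _

/-- A field on `T(W × ℝ)` projects onto the conservative motion if its spatial acceleration solves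
Newton's equation. -/
theorem specializationProjectsTo_of_accelForm
    (hD' : IsEquationOfMotion T' (HorizontalForm.ofBase fun x => mvfderiv 𝓘(ℝ, E) U x) D')
    {f : M' → ℝ} (hf0 : ∀ q ∈ W, f q ≠ 0) {D : FieldOnTangent (extModel E) (W × ℝ)}
    (hD : IsSecondOrder D)
    (h : ∀ v : TangentBundle (extModel E) (W × ℝ),
      f (baseProj W v.proj) * (components v).2 = 1 → ∀ a : E,
        accelForm (T'.coord (baseProj W v.proj))
          (extChartAt 𝓘(ℝ, E) (baseProj W v.proj) (baseProj W v.proj))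
          (components v).1 (D v : (E × ℝ) × (E × ℝ)).2.1 a +
        differential 𝓘(ℝ, E) U (baseProj W v.proj) a = 0) :
    SpecializationProjectsTo W
      (HorizontalForm.ofBase fun z : W × ℝ => f z.1 • dTime (E := E) W z) D D' := by
  constructor
  · intro u hu
    -- The time velocity `1 / f` normalizes `τ̇` to `1`; the instant `x⁰ = 0` is arbitrary.
    refine ⟨⟨(⟨u.proj, hu⟩, 0), ((components u, (f u.proj)⁻¹) : E × ℝ)⟩, ?_, ?_⟩
    · rw [dot_smul_dTime]
      exact mul_inv_cancel₀ (hf0 _ hu)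
    · rw [tangentMap_baseProj]
      rfl
  · intro v hv
    rw [dot_smul_dTime] at hv
    set u := tangentMap (extModel E) 𝓘(ℝ, E) (baseProj W) v with hu
    refine (mfderiv_tangentMap_baseProj v (D v)).trans ?_
    have h1 : (components v).1 = components u :=
      (mfderiv_baseProj v.proj (components v)).symm
    have h2 := (accelForm_add_eq_zero_iff (T'.coord_nondegenerate
      (mem_extChartAt_target (baseProj W v.proj))) _ _
      (differential 𝓘(ℝ, E) U (baseProj W v.proj))).mp (h v hv)
    have h3 : (D v : (E × ℝ) × (E × ℝ)).1.1 = components u := by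
      rw [← h1]
      exact congrArg (fun ξ : (E × ℝ) × (E × ℝ) => ξ.1.1) (hD.eq_mk v)
    rw [h1] at h2
    rw [T'.eq_motion_of_isEquationOfMotion hD']
    exact Prod.ext h3 h2

/-- The force that keeps `ẋ⁰` constant in a static system. -/
def reactionForm (W : Opens M') (f : M' → ℝ) : HorizontalForm (extModel E) (W × ℝ) := fun v =>
  -(differential 𝓘(ℝ, E) f (baseProj W v.proj) (components v).1 * (components v).2) •
    dTime (E := E) W v.proj

omit [FiniteDimensional ℝ E] [IsManifold 𝓘(ℝ, E) ∞ M'] in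
theorem reactionForm_covec (f : M' → ℝ) (v : TangentBundle (extModel E) (W × ℝ)) (a : E × ℝ) :
    (reactionForm W f).covec v a =
      -(differential 𝓘(ℝ, E) f (baseProj W v.proj) (components v).1 * (components v).2) * a.2 :=
  congrArg (fun r : ℝ =>
    -(differential 𝓘(ℝ, E) f (baseProj W v.proj) (components v).1 * (components v).2) * r)
    (dTime_apply v.proj a)

omit [FiniteDimensional ℝ E] in
theorem isSmooth_reactionForm {f : M' → ℝ} (hf : ContMDiff 𝓘(ℝ, E) 𝓘(ℝ, ℝ) ∞ f) :
    (reactionForm (E := E) W f).IsSmooth := by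
  intro z y hy
  set ψ := extChartAt 𝓘(ℝ, E) (baseProj W z)
  have h1 : ContDiffAt ℝ ∞ (fun x : (E × ℝ) × (E × ℝ) => fderiv ℝ (f ∘ ψ.symm) x.1.1) y :=
    ((contDiffAt_comp_symm hf (ext_symm_eq hy).1).fderiv_right (m := ∞) le_rfl).comp y
      (contDiffAt_fst.comp y contDiffAt_fst)
  have h2 : ContDiffAt ℝ ∞ (fun x : (E × ℝ) × (E × ℝ) =>
      -(fderiv ℝ (f ∘ ψ.symm) x.1.1 x.2.1 * x.2.2) • ContinuousLinearMap.snd ℝ E ℝ) y :=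
    ((h1.clm_apply (contDiffAt_fst.comp y contDiffAt_snd)).mul
      (contDiffAt_snd.comp y contDiffAt_snd)).neg.smul contDiffAt_const
  refine h2.congr_of_eventuallyEq ?_
  filter_upwards [(continuous_fst.tendsto y).eventually (extChartAt_target_mem_nhds_of_mem hy)]
    with x hx
  refine ContinuousLinearMap.ext fun a => ?_
  have h3 : components (⟨(extChartAt (extModel E) z).symm x.1,
      frame (extModel E) z x.1 x.2⟩ : TangentBundle (extModel E) (W × ℝ)) =
      (frame 𝓘(ℝ, E) (baseProj W z) x.1.1 x.2.1, x.2.2) := frame_ext hx x.2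
  rw [HorizontalForm.coord_apply, reactionForm_covec, h3, frame_ext hx a,
    ← differential_frame hf (ext_symm_eq hx).1, ← (ext_symm_eq hx).2.1]
  rfl

/-- The unknown multiplier of `dx⁰` is determined by the constraint, so the constrained system is an
ordinary one with the force `reactionForm`; existence and uniqueness are then those of an equation
of motion. -/
theorem isHolonomicTimeConstraintOver (hU : ContMDiff 𝓘(ℝ, E) 𝓘(ℝ, ℝ) ∞ U)
    (hD' : IsEquationOfMotion T' (HorizontalForm.ofBase fun x => mvfderiv 𝓘(ℝ, E) U x) D')
    {c : ℝ} (hc : ∀ q ∈ W, U q ≠ c) : IsHolonomicTimeConstraintOver T' D' W := by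
  -- This choice gives `-½ df = dU`.
  set f : M' → ℝ := fun q => 2 * (c - U q) with hf_def
  have hf : ContMDiff 𝓘(ℝ, E) 𝓘(ℝ, ℝ) ∞ f := contMDiff_const.mul (contMDiff_const.sub hU)
  have hf0 : ∀ q ∈ W, f q ≠ 0 := fun q hq =>
    mul_ne_zero two_ne_zero (sub_ne_zero.mpr (hc q hq).symm)
  have hdf : ∀ q a, differential 𝓘(ℝ, E) f q a = -2 * differential 𝓘(ℝ, E) U q a := by
    intro q a
    have h := ((hasFDerivAt_differential ((hU q).mdifferentiableAt (by simp))).const_sub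
      c).const_mul 2
    rw [differential_eq_of_hasFDerivAt (f := f) h]
    simp
  -- Writing `dx⁰` as `1 • dx⁰` brings it under the lemmas about constraints `f dx⁰`.
  have hdot : (HorizontalForm.ofBase (dTime W) : HorizontalForm (extModel E) (W × ℝ)) =
      HorizontalForm.ofBase fun z : W × ℝ => (fun _ : M' => (1 : ℝ)) z.1 • dTime (E := E) W z := by
    simp
  set T := staticMetric T' f hf.contMDiffOn hf0
  have hsmooth : (reactionForm (E := E) W f).IsSmooth := isSmooth_reactionForm hf
  have hone : ∀ q, differential 𝓘(ℝ, E) (fun _ : M' => (1 : ℝ)) q = 0 := fun q =>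
    differential_eq_of_hasFDerivAt (hasFDerivAt_const (1 : ℝ) _)
  have htan : ∀ (D : FieldOnTangent (extModel E) (W × ℝ))
      (v : TangentBundle (extModel E) (W × ℝ)),
      mvfderiv (extModel E).tangent
        (HorizontalForm.ofBase (dTime W) : HorizontalForm (extModel E) (W × ℝ)).dot v (D v) =
      (D v : (E × ℝ) × (E × ℝ)).2.2 := by
    intro D v
    rw [hdot]
    refine (mvfderiv_dot_smul_dTime mdifferentiableAt_const (D v)).trans ?_
    simp [hone]
  have hbase : ∀ (v : TangentBundle (extModel E) (W × ℝ)) (ξ : (E × ℝ) × (E × ℝ)),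
      ((HorizontalForm.ofBase (dTime W) : HorizontalForm (extModel E) (W × ℝ)).toOneForm v :
        (E × ℝ) × (E × ℝ) →L[ℝ] ℝ) ξ = ξ.1.2 := fun v ξ =>
    (HorizontalForm.toOneForm_apply _ v ξ).trans (dTime_apply v.proj ξ.1)
  have hnewton : ∀ (D : FieldOnTangent (extModel E) (W × ℝ))
      (v : TangentBundle (extModel E) (W × ℝ)) (ξ : (E × ℝ) × (E × ℝ)),
      T.newtonForm (reactionForm W f) D v ξ = T.newtonForm (fun _ => 0) D v ξ -
        differential 𝓘(ℝ, E) f (baseProj W v.proj) (components v).1 * (components v).2 * ξ.1.2 := by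
    intro D v ξ
    have h1 : ((reactionForm W f).toOneForm v : (E × ℝ) × (E × ℝ) →L[ℝ] ℝ) ξ =
        -(differential 𝓘(ℝ, E) f (baseProj W v.proj) (components v).1 * (components v).2) * ξ.1.2 :=
      (HorizontalForm.toOneForm_apply _ v ξ).trans (reactionForm_covec f v ξ.1)
    have h2 : (HorizontalForm.toOneForm (I := extModel E) (N := W × ℝ) (fun _ => 0) v :
        (E × ℝ) × (E × ℝ) →L[ℝ] ℝ) ξ = 0 := HorizontalForm.toOneForm_apply _ v ξ
    refine (congrArg _ h1).trans (Eq.trans ?_ (congrArg (fun r : ℝ => T.omega v (D v) ξ +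
      mvfderiv (extModel E).tangent T.kinetic v ξ + r - differential 𝓘(ℝ, E) f
        (baseProj W v.proj) (components v).1 * (components v).2 * ξ.1.2) h2).symm)
    ring
  have hiff : ∀ D, IsTimeConstrained T (fun _ => 0) (HorizontalForm.ofBase (dTime W)) D ↔
      IsEquationOfMotion T (reactionForm W f) D := by
    intro D
    constructor
    · intro hD
      refine ⟨hD.toIsSecondOrder, fun v ξ => ?_⟩
      obtain ⟨k, hk⟩ := hD.newton
      have h0 : (D v : (E × ℝ) × (E × ℝ)).2.2 = 0 := (htan D v).symm.trans (hD.tangent v)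
      -- Testing on `∂/∂x⁰`, with `ẍ⁰ = 0`, identifies the multiplier: `k = df(ẋ) ẋ⁰`.
      have h1 := (newtonForm_staticMetric T' hf.contMDiffOn hf0 hD.toIsSecondOrder v
        ((0, 1), 0)).symm.trans ((hk v _).trans (congrArg (fun r => k v * r) (hbase v _)))
      have h2 := (hk v ξ).trans (congrArg (fun r => k v * r) (hbase v ξ))
      rw [h0] at h1
      simp [accelForm_zero] at h1
      refine (hnewton D v ξ).trans ?_
      rw [h1, ← h2]
      exact sub_self _
    · intro hD
      have h0 : ∀ v (ξ : (E × ℝ) × (E × ℝ)), T.newtonForm (fun _ => 0) D v ξ =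
          differential 𝓘(ℝ, E) f (baseProj W v.proj) (components v).1 * (components v).2 *
            ξ.1.2 := fun v ξ =>
        sub_eq_zero.mp ((hnewton D v ξ).symm.trans (hD.newton v ξ))
      refine ⟨hD.toIsSecondOrder, ⟨_, fun v ξ =>
        (h0 v ξ).trans (congrArg (fun r => _ * r) (hbase v ξ).symm)⟩, fun v => ?_⟩
      refine (htan D v).trans ?_
      -- Testing on `∂/∂x⁰`, the reaction cancels `df(ẋ) ẋ⁰` and leaves `f ẍ⁰ = 0`; as `f ≠ 0`, the
      -- field is tangent to `ẋ⁰ = const`.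
      have h1 := (newtonForm_staticMetric T' hf.contMDiffOn hf0 hD.toIsSecondOrder v
        ((0, 1), 0)).symm.trans (h0 v _)
      simpa [accelForm_zero, hf0 _ v.proj.1.2, baseProj] using h1
  refine ⟨fun q => f q, T, hf.comp contMDiff_subtype_val, fun q => hf0 q q.2,
    isStaticExtension_staticMetric T' f _ _, isHolonomic_dTime, ?_, ?_⟩
  · simp only [hiff]
    exact T.existsUnique_isEquationOfMotion hsmooth
  · intro D hD
    rw [hdot]
    refine specializationProjectsTo_of_accelForm T' hD' (fun _ _ => one_ne_zero)
      hD.toIsSecondOrder fun v hv a => ?_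
    rw [one_mul] at hv
    have h1 := (newtonForm_staticMetric T' hf.contMDiffOn hf0 hD.toIsSecondOrder v
      ((a, 0), 0)).symm.trans (sub_eq_zero.mp
        ((hnewton D v ((a, 0), 0)).symm.trans (((hiff D).mp hD).newton v _)))
    simp only [hv, hdf] at h1
    linarith

omit [FiniteDimensional ℝ E] in
/-- The constraint `f dx⁰` is holonomic only if `f` is locally constant. -/
theorem differential_eq_zero_of_isHolonomic {f : M' → ℝ}
    (hf : ∀ q ∈ W, MDifferentiableAt 𝓘(ℝ, E) 𝓘(ℝ, ℝ) f q)
    (h : IsHolonomic (I := extModel E)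
      (HorizontalForm.ofBase fun z : W × ℝ => f z.1 • dTime (E := E) W z))
    (q : M') (hq : q ∈ W) : differential 𝓘(ℝ, E) f q = 0 := by
  obtain ⟨F, hF, hτ⟩ := h
  have hdF : ∀ (p : W × ℝ) (v : E × ℝ), differential (extModel E) F p v =
      f (baseProj W p) * v.2 := by
    intro p v
    have h1 := congrFun hτ (⟨p, 0⟩ : TangentBundle (extModel E) (W × ℝ))
    have h2 : f (baseProj W p) * (dTime W p : E × ℝ →L[ℝ] ℝ) v = differential (extModel E) F p v :=
      congrArg (fun L : E × ℝ →L[ℝ] ℝ => L v) h1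
    rw [← h2, dTime_apply]
  set z : W × ℝ := (⟨q, hq⟩, 0)
  set ψ := extChartAt (extModel E) z
  have hz : ψ z ∈ ψ.target := mem_extChartAt_target z
  have h1 : HasFDerivAt (f ∘ (extChartAt 𝓘(ℝ, E) q).symm) (differential 𝓘(ℝ, E) f q) (ψ z).1 :=
    hasFDerivAt_differential (hf q hq)
  -- In the chart a primitive `F` has derivative `f dx⁰`, so `D²F((a, 0), (0, 1)) = df(a)`, while
  -- `D²F((0, 1), (a, 0)) = 0`; symmetry of `D²F` gives the claim.
  have h2 : fderiv ℝ (F ∘ ψ.symm) =ᶠ[nhds (ψ z)] fun y =>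
      (f ∘ (extChartAt 𝓘(ℝ, E) q).symm) y.1 • ContinuousLinearMap.snd ℝ E ℝ := by
    filter_upwards [extChartAt_target_mem_nhds_of_mem hz] with y hy
    refine ContinuousLinearMap.ext fun v => ?_
    rw [← differential_frame hF hy, hdF, frame_ext hy, (ext_symm_eq hy).2.1]
    rfl
  have h3 := ((h1.comp (ψ z) hasFDerivAt_fst).smul_const
    (ContinuousLinearMap.snd ℝ E ℝ)).congr_of_eventuallyEq h2
  have h4 : IsSymmSndFDerivAt ℝ (F ∘ ψ.symm) (ψ z) :=
    (contDiffAt_comp_symm hF hz).isSymmSndFDerivAt (by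
      rw [minSmoothness_of_isRCLikeNormedField]; norm_cast)
  ext a
  have h5 := h4.eq (a, 0) (0, 1)
  rw [h3.fderiv] at h5
  simpa using h5

/-- No multiplier is needed here: the time component of the geodesic equation is itself the
conservation of `f ẋ⁰`, because `x⁰` is a cyclic coordinate. -/
theorem isNonholonomicTimeConstraintOver (hU : ContMDiff 𝓘(ℝ, E) 𝓘(ℝ, ℝ) ∞ U)
    (hD' : IsEquationOfMotion T' (HorizontalForm.ofBase fun x => mvfderiv 𝓘(ℝ, E) U x) D')
    {c : ℝ} (hc : ∀ q ∈ W, U q ≠ c) : IsNonholonomicTimeConstraintOver T' U D' W := by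
  -- This choice gives `½ d(1/f) = dU`. Where `U = c`, outside `W`, the inverse takes its default
  -- value `0`; hence smoothness is asserted on `W` only.
  set f : M' → ℝ := fun q => (2 * (U q - c))⁻¹ with hf_def
  have hU0 : ∀ q ∈ W, 2 * (U q - c) ≠ 0 := fun q hq =>
    mul_ne_zero two_ne_zero (sub_ne_zero.mpr (hc q hq))
  have hf : ContMDiffOn 𝓘(ℝ, E) 𝓘(ℝ, ℝ) ∞ f W := by
    intro q hq
    have h1 : ContMDiffAt 𝓘(ℝ, E) 𝓘(ℝ, ℝ) ∞ (fun q => 2 * (U q - c)) q :=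
      (contMDiff_const.mul (hU.sub contMDiff_const)) q
    have h2 : ContMDiffAt 𝓘(ℝ, ℝ) 𝓘(ℝ, ℝ) ∞ (fun x : ℝ => x⁻¹) (2 * (U q - c)) :=
      (contDiffAt_inv ℝ (hU0 q hq)).contMDiffAt
    exact (h2.comp q h1).contMDiffWithinAt
  have hf0 : ∀ q ∈ W, f q ≠ 0 := fun q hq => inv_ne_zero (hU0 q hq)
  have hfd : ∀ q ∈ W, MDifferentiableAt 𝓘(ℝ, E) 𝓘(ℝ, ℝ) f q := fun q hq =>
    (hf.contMDiffAt (W.2.mem_nhds hq)).mdifferentiableAt (by simp)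
  have hdf : ∀ q ∈ W, ∀ a, differential 𝓘(ℝ, E) f q a =
      -2 * f q ^ 2 * differential 𝓘(ℝ, E) U q a := by
    intro q hq a
    have h := ((hasFDerivAt_differential ((hU q).mdifferentiableAt (by simp))).sub_const
      c).const_mul 2
    have h' := (hasDerivAt_inv (hU0 q hq)).comp_hasFDerivAt_of_eq _ h (by simp)
    rw [differential_eq_of_hasFDerivAt (f := f) h']
    have h2 : (-((2 * (U q - c)) ^ 2)⁻¹ • (2 : ℝ) • differential 𝓘(ℝ, E) U q) a =
        -((2 * (U q - c)) ^ 2)⁻¹ * (2 * differential 𝓘(ℝ, E) U q a) := rfl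
    rw [h2, ← inv_pow]
    ring
  set T := staticMetric T' f hf hf0
  refine ⟨fun q => f q, T, fun q => ?_, fun q => hf0 q q.2,
    isStaticExtension_staticMetric T' f _ _, ?_,
    T.existsUnique_isEquationOfMotion HorizontalForm.isSmooth_zero, ?_⟩
  · exact (hf.contMDiffAt (W.2.mem_nhds q.2)).comp q contMDiff_subtype_val.contMDiffAt
  · intro hτ q hq
    have h1 := differential_eq_zero_of_isHolonomic (fun q hq => hfd q hq) hτ q hq
    refine ContinuousLinearMap.ext fun a => ?_
    have h2 := hdf q hq a
    rw [h1] at h2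
    have h3 : -2 * f q ^ 2 ≠ 0 := mul_ne_zero (by norm_num) (pow_ne_zero 2 (hf0 q hq))
    exact (mul_eq_zero.mp h2.symm).resolve_left h3
  · intro D hD
    have h1 : ∀ v (ξ : (E × ℝ) × (E × ℝ)), _ = (0 : ℝ) := fun v ξ =>
      (newtonForm_staticMetric T' hf hf0 hD.toIsSecondOrder v ξ).symm.trans (hD.newton v ξ)
    constructor
    · intro v
      refine (mvfderiv_dot_smul_dTime (hfd _ v.proj.1.2) (D v)).trans ?_
      -- Testing on `∂/∂x⁰` gives `f ẍ⁰ + df(ẋ) ẋ⁰ = 0`.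
      have h2 := h1 v ((0, 1), 0)
      have h3 : (D v : (E × ℝ) × (E × ℝ)).1.1 = (components v).1 :=
        congrArg (fun ξ : (E × ℝ) × (E × ℝ) => ξ.1.1) (hD.eq_mk v)
      simp [accelForm_zero] at h2
      rw [h3]
      linarith
    · refine specializationProjectsTo_of_accelForm T' hD' hf0 hD.toIsSecondOrder fun v hv a => ?_
      have h2 := h1 v ((a, 0), 0)
      have h4 := hdf (baseProj W v.proj) v.proj.1.2 a
      have h3 : f (baseProj W v.proj) ^ 2 * ((components v).2 * (components v).2) = 1 := by
        rw [← pow_two, ← mul_pow, hv, one_pow]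
      -- The force is `-½ df (ẋ⁰)² = f² (ẋ⁰)² dU`, and `f ẋ⁰ = 1`.
      linear_combination h2 + 1 / 2 * (components v).2 ^ 2 * h4 -
        differential 𝓘(ℝ, E) U (baseProj W v.proj) a * h3

end TimeConstraints

end Mechanics

end

theorem mainTheorem5 {E : Type*} [NormedAddCommGroup E] [NormedSpace ℝ E] [FiniteDimensional ℝ E]
    {M' : Type*} [TopologicalSpace M'] [ChartedSpace E M'] [IsManifold 𝓘(ℝ, E) ∞ M']
    (T' : Mechanics.PseudoRiemannianMetric 𝓘(ℝ, E) M')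
    (U : M' → ℝ) (hU : ContMDiff 𝓘(ℝ, E) 𝓘(ℝ, ℝ) ∞ U) :
    (∃! D', Mechanics.IsEquationOfMotion T'
      (Mechanics.HorizontalForm.ofBase fun x => mvfderiv 𝓘(ℝ, E) U x) D') ∧
    ∀ D', Mechanics.IsEquationOfMotion T'
        (Mechanics.HorizontalForm.ofBase fun x => mvfderiv 𝓘(ℝ, E) U x) D' →
      (∀ p : M', ∃ W : Opens M', p ∈ W ∧
        Mechanics.IsHolonomicTimeConstraintOver T' D' W ∧
        Mechanics.IsNonholonomicTimeConstraintOver T' U D' W) ∧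
      (∀ W : Opens M', (∃ c : ℝ, ∀ q ∈ W, U q ≠ c) →
        Mechanics.IsHolonomicTimeConstraintOver T' D' W ∧
        Mechanics.IsNonholonomicTimeConstraintOver T' U D' W) := by
  have hsmooth := Mechanics.isSmooth_ofBase_mvfderiv hU
  refine ⟨T'.existsUnique_isEquationOfMotion hsmooth, fun D' hD' => ⟨fun p => ?_, ?_⟩⟩
  · have hc : ∀ q ∈ (⟨{q | U q < U p + 1}, isOpen_lt hU.continuous continuous_const⟩ : Opens M'),
        U q ≠ U p + 1 := fun q hq => ne_of_lt hq
    exact ⟨_, show U p < U p + 1 by linarith,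
      Mechanics.isHolonomicTimeConstraintOver T' hU hD' hc,
      Mechanics.isNonholonomicTimeConstraintOver T' hU hD' hc⟩
  · rintro W ⟨c, hc⟩
    exact ⟨Mechanics.isHolonomicTimeConstraintOver T' hU hD' hc,
      Mechanics.isNonholonomicTimeConstraintOver T' hU hD' hc⟩
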